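/- **Theorem 2.2.** Let $I, V, W$ be complex vector spaces of dimensions $2$, $n+1$ and $m+2$, where $n,m\ge 0$ and $m+2\le 2(n+1)$. Let $X=(\mathrm{Hom}(W,I\otimes V)\setminus\{0\})/\mathbb C^*$, with the action of $G=\mathrm{SL}(I)\times \mathrm{SL}(W)$ given by $(g,h)\cdot A=(g\otimes \mathrm{id}_V)\circ A\circ h^{-1}$, and let $X^{ss}\subseteq X$ be the set of points that are semistable in the sense of geometric invariant theory: those $A$ at which some $G$-invariant homogeneous polynomial of positive degree on $\mathrm{Hom}(W,I\otimes V)$ does not vanish. For $A\in X$ let $T_A=A(W)\subseteq I\otimes V$, and let $D(A)\subseteq \mathbb P^n=(V^*\setminus\{0\})/\mathbb C^*$ be the degeneracy locus of the induced morphism $I^*\otimes\mathcal O_{\mathbb P^n}\to W^*\otimes\mathcal O_{\mathbb P^n}(1)$, i.e. the set of points $[\xi]$ at which the linear map $I^*\to W^*$, $\varphi\mapsto(\varphi\otimes\xi)\circ A$, has rank at most $1$. Dimensions of subsets of $\mathbb P^n$ are Krull dimensions in the Zariski topology, with $\dim\emptyset=-1$. For $j\in\mathbb N$ put $$S^j=\{A\in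 X^{ss}\mid \exists\,\omega\in I\setminus\{0\}:\ \dim\big((\omega\otimes V)\cap T_A\big)\ge j+m-n\},$$ $$\tilde S^j=\{A\in X^{ss}\mid \dim D(A)\ge j-2\}.$$ Then: 1. $S^j\subseteq\tilde S^j\subseteq S^{j-1}$ for all $j\ge 2$; 2. $S^2=\tilde S^2$; 3. $S^1=\tilde S^1=X^{ss}$. In particular, with $j_0=\lfloor\frac{m+3}{2}\rfloor+n-m$, these subsets, all of which are $G$-invariant, form a single filtration $$\emptyset=S^{j_0+1}\subseteq\tilde S^{j_0+1}\subseteq S^{j_0}\subseteq\tilde S^{j_0}\subseteq\dots\subseteq S^3\subseteq\tilde S^3\subseteq S^2=\tilde S^2\subseteq S^1=\tilde S^1=X^{ss}.$$ -/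

import Mathlib

open scoped TensorProduct LinearAlgebra.Projectivization

noncomputable section

namespace SteinerFiltration

/-! ### Forms and the Zariski topology on a complex projective space -/

section Projective

variable {E : Type*} [AddCommGroup E] [Module ℂ E]

/-- The value at `e` of a polynomial in the linear functionals on `E`. -/
def evalForm (p : MvPolynomial (Module.Dual ℂ E) ℂ) (e : E) : ℂ :=
  MvPolynomial.eval (fun l : Module.Dual ℂ E => l e) p

/-- The common zero locus in `ℙ(E) = (E ∖ 0)/ℂˣ` of a set of forms on `E`. For homogeneous
polynomials, vanishing at a point does not depend on the chosen representative. -/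
def zeroLocus (F : Set (MvPolynomial (Module.Dual ℂ E) ℂ)) : Set (ℙ ℂ E) :=
  {x | ∀ p ∈ F, evalForm p x.rep = 0}

/-- A Zariski closed subset of `ℙ(E)` is the common zero locus of a set of homogeneous
polynomials. -/
def IsZariskiClosed (Z : Set (ℙ ℂ E)) : Prop :=
  ∃ F : Set (MvPolynomial (Module.Dual ℂ E) ℂ),
    (∀ p ∈ F, ∃ d : ℕ, p.IsHomogeneous d) ∧ Z = zeroLocus F

theorem isZariskiClosed_empty : IsZariskiClosed (∅ : Set (ℙ ℂ E)) := by
  refine ⟨{1}, ?_, ?_⟩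
  · rintro p rfl
    exact ⟨0, MvPolynomial.isHomogeneous_one _ _⟩
  · ext x
    simp [zeroLocus, evalForm]

theorem isZariskiClosed_sInter (A : Set (Set (ℙ ℂ E))) (hA : ∀ Z ∈ A, IsZariskiClosed Z) :
    IsZariskiClosed (⋂₀ A) := by
  refine ⟨{p | (∃ d : ℕ, p.IsHomogeneous d) ∧
    ∃ Z ∈ A, ∀ x ∈ Z, evalForm p x.rep = 0}, fun p hp => hp.1, ?_⟩
  ext x
  constructor
  · rintro hx p ⟨-, Z, hZ, hpZ⟩
    exact hpZ x (hx Z hZ)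
  · intro hx Z hZ
    obtain ⟨F, hF, rfl⟩ := hA Z hZ
    intro p hp
    exact hx p ⟨hF p hp, _, hZ, fun y hy => hy p hp⟩

theorem isZariskiClosed_union {Y Z : Set (ℙ ℂ E)} (hY : IsZariskiClosed Y)
    (hZ : IsZariskiClosed Z) : IsZariskiClosed (Y ∪ Z) := by
  obtain ⟨F, hF, rfl⟩ := hY
  obtain ⟨G, hG, rfl⟩ := hZ
  refine ⟨{r | ∃ p ∈ F, ∃ q ∈ G, r = p * q}, ?_, ?_⟩
  · rintro r ⟨p, hp, q, hq, rfl⟩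
    obtain ⟨d, hd⟩ := hF p hp
    obtain ⟨e, he⟩ := hG q hq
    exact ⟨d + e, hd.mul he⟩
  · ext x
    constructor
    · rintro (hx | hx) r ⟨p, hp, q, hq, rfl⟩
      · have := hx p hp
        simp only [evalForm, map_mul] at this ⊢
        rw [this, zero_mul]
      · have := hx q hq
        simp only [evalForm, map_mul] at this ⊢
        rw [this, mul_zero]
    · intro hx
      by_contra hcon
      simp only [Set.mem_union, not_or, zeroLocus, Set.mem_ofPred_eq, not_forall] at hcon
      obtain ⟨⟨p, hp, hpx⟩, q, hq, hqx⟩ := hcon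
      have := hx (p * q) ⟨p, hp, q, hq, rfl⟩
      simp only [evalForm, map_mul] at this hpx hqx
      exact (mul_ne_zero hpx hqx) this

/-- The Zariski topology on `ℙ(E)`. -/
abbrev zariskiTopology (E : Type*) [AddCommGroup E] [Module ℂ E] : TopologicalSpace (ℙ ℂ E) :=
  TopologicalSpace.ofClosed {Z | IsZariskiClosed Z} isZariskiClosed_empty
    (fun A hA => isZariskiClosed_sInter A hA) (fun _ hY _ hZ => isZariskiClosed_union hY hZ)

/-- The Krull dimension of a subset of `ℙ(E)` in the topology induced by the Zariski topology
(it is `⊥` for the empty subset). -/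
def zariskiDim (Y : Set (ℙ ℂ E)) : WithBot ℕ∞ :=
  @topologicalKrullDim Y (TopologicalSpace.induced Subtype.val (zariskiTopology E))

/-- `dim Y ≥ d` for an integer `d`, where the empty set has dimension `-1`: there is nothing to
check for `d < 0`, and for `d ≥ 0` the Krull dimension of `Y` is at least `d`. -/
def DimGE (Y : Set (ℙ ℂ E)) (d : ℤ) : Prop :=
  d ≤ -1 ∨ ((d.toNat : ℕ∞) : WithBot ℕ∞) ≤ zariskiDim Y

end Projective

/-! ### Tensors, semistability and the two families of subsets -/

section Tensors

variable {I V W : Type*} [AddCommGroup I] [Module ℂ I] [AddCommGroup V] [Module ℂ V]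
  [AddCommGroup W] [Module ℂ W]

/-- The subspace `R_ω = ω ⊗ V` of `I ⊗ V`. -/
def R (V : Type*) [AddCommGroup V] [Module ℂ V] (ω : I) : Submodule ℂ (I ⊗[ℂ] V) :=
  LinearMap.range (TensorProduct.mk ℂ I V ω)

/-- The image `T_A = A(W)`, for a point `A` of `ℙ(Hom(W, I ⊗ V))`. -/
def T (A : ℙ ℂ (W →ₗ[ℂ] I ⊗[ℂ] V)) : Submodule ℂ (I ⊗[ℂ] V) :=
  LinearMap.range A.rep

/-- For `ξ ∈ V^*`, the map `I^* → W^*` sending `φ` to `w ↦ (φ ⊗ ξ)(B w)`: the fibre at the point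
`[ξ]` of `ℙ(V^*)` of the sheaf map `I^* ⊗ 𝒪 → W^* ⊗ 𝒪(1)` induced by `B`. -/
def fiberMap (B : W →ₗ[ℂ] I ⊗[ℂ] V) (ξ : Module.Dual ℂ V) :
    Module.Dual ℂ I →ₗ[ℂ] Module.Dual ℂ W :=
  B.dualMap ∘ₗ TensorProduct.dualDistrib ℂ I V ∘ₗ
    (TensorProduct.mk ℂ (Module.Dual ℂ I) (Module.Dual ℂ V)).flip ξ

theorem fiberMap_apply (B : W →ₗ[ℂ] I ⊗[ℂ] V) (ξ : Module.Dual ℂ V) (φ : Module.Dual ℂ I)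
    (w : W) : fiberMap B ξ φ w = TensorProduct.dualDistrib ℂ I V (φ ⊗ₜ[ℂ] ξ) (B w) := rfl

/-- The degeneracy locus `D(A)`: the points of `ℙ(V^*)` where the sheaf map induced by `A` has
rank at most one. -/
def D (A : ℙ ℂ (W →ₗ[ℂ] I ⊗[ℂ] V)) : Set (ℙ ℂ (Module.Dual ℂ V)) :=
  {x | Module.finrank ℂ (LinearMap.range (fiberMap A.rep x.rep)) ≤ 1}

/-- The action of `(g, h) ∈ SL(I) × SL(W)` on `Hom(W, I ⊗ V)`: `B ↦ (g ⊗ id_V) ∘ B ∘ h⁻¹`. -/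
def act (V : Type*) [AddCommGroup V] [Module ℂ V]
    (g : SpecialLinearGroup ℂ I) (h : SpecialLinearGroup ℂ W) :
    (W →ₗ[ℂ] I ⊗[ℂ] V) ≃ₗ[ℂ] (W →ₗ[ℂ] I ⊗[ℂ] V) :=
  LinearEquiv.arrowCongr h.1 (TensorProduct.congr g.1 (LinearEquiv.refl ℂ V))

theorem act_apply (g : SpecialLinearGroup ℂ I) (h : SpecialLinearGroup ℂ W)
    (B : W →ₗ[ℂ] I ⊗[ℂ] V) (w : W) :
    act V g h B w = TensorProduct.map g.1.toLinearMap LinearMap.id (B (h.1.symm w)) := rfl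

/-- The induced action of `(g, h) ∈ SL(I) × SL(W)` on `ℙ(Hom(W, I ⊗ V))`. -/
def actP (g : SpecialLinearGroup ℂ I) (h : SpecialLinearGroup ℂ W) :
    ℙ ℂ (W →ₗ[ℂ] I ⊗[ℂ] V) → ℙ ℂ (W →ₗ[ℂ] I ⊗[ℂ] V) :=
  Projectivization.map (act V g h).toLinearMap (act V g h).injective

/-- A subset of `ℙ(Hom(W, I ⊗ V))` is invariant under `SL(I) × SL(W)`. -/
def IsInvariant (Y : Set (ℙ ℂ (W →ₗ[ℂ] I ⊗[ℂ] V))) : Prop :=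
  ∀ (g : SpecialLinearGroup ℂ I) (h : SpecialLinearGroup ℂ W), ∀ A ∈ Y, actP g h A ∈ Y

variable (I V W)

/-- The semistable locus (geometric invariant theory) for the action of `SL(I) × SL(W)`: some
invariant form of positive degree on `Hom(W, I ⊗ V)` does not vanish at `A`. -/
def Xss : Set (ℙ ℂ (W →ₗ[ℂ] I ⊗[ℂ] V)) :=
  {A | ∃ d : ℕ, 0 < d ∧ ∃ p : MvPolynomial (Module.Dual ℂ (W →ₗ[ℂ] I ⊗[ℂ] V)) ℂ,
    p.IsHomogeneous d ∧
    (∀ (g : SpecialLinearGroup ℂ I) (h : SpecialLinearGroup ℂ W) (B : W →ₗ[ℂ] I ⊗[ℂ] V),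
      evalForm p (act V g h B) = evalForm p B) ∧
    evalForm p A.rep ≠ 0}

/-- The set `S^j`: semistable `A` with `dim (R_ω ∩ T_A) ≥ j + m - n` for some nonzero `ω ∈ I`. -/
def S (n m j : ℕ) : Set (ℙ ℂ (W →ₗ[ℂ] I ⊗[ℂ] V)) :=
  {A | A ∈ Xss I V W ∧ ∃ ω : I, ω ≠ 0 ∧
    (j : ℤ) + m - n ≤ (Module.finrank ℂ (R V ω ⊓ T A : Submodule ℂ (I ⊗[ℂ] V)) : ℤ)}

/-- The set `S̃^j`: semistable `A` with `dim D(A) ≥ j - 2`. -/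
def Stilde (j : ℕ) : Set (ℙ ℂ (W →ₗ[ℂ] I ⊗[ℂ] V)) :=
  {A | A ∈ Xss I V W ∧ DimGE (D A) ((j : ℤ) - 2)}

/-- The interleaved sequence `S̃^1, S^1, S̃^2, S^2, S̃^3, S^3, …`, indexed from `0`. -/
def interleaved (n m k : ℕ) : Set (ℙ ℂ (W →ₗ[ℂ] I ⊗[ℂ] V)) :=
  if Even k then Stilde I V W (k / 2 + 1) else S I V W n m (k / 2 + 1)

end Tensors

end SteinerFiltration

end

open SteinerFiltration

open scoped TensorProduct LinearAlgebra.Projectivization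

namespace SteinerFiltration

/-! For a nonzero functional `φ` on `I` with kernel spanned by `ω`, contraction by `φ` has kernel `R
V ω`. A semistable `A` is injective, so the slice `contract V φ ∘ₗ A.rep` has rank `m + 2 - dim (R V
ω ⊓ T A)` (`finrank_slice_add`). Hence `A` lies in `S^j` exactly when some slice has corank at least
`j - 1`.

By `mem_D_iff`, `D A` is the union over `φ` of the linear spaces cut out by the ranges of the
slices. A slice of corank `c ≥ 1` contributes a `ℙ^(c-1)`, which gives `S^j ⊆ S̃^j`. Conversely, if
all coranks are at most `k`, then `D A` is swept out by a one-parameter family of linear spaces of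
dimension at most `k - 1`, so its dimension is at most `k` (`zariskiDim_D_le`); this gives `S̃^(j+1)
⊆ S^j`. A single point of `D A` already forces a slice of positive corank, whence `S^2 = S̃^2`.

The dimension bound is a transcendence degree count. The generic point of the cone over an
irreducible `Z ⊆ D A` is a linear map `x` from `V` to a field, and `x` makes the two basic slices
proportional with some ratio `τ`; its values lie in a field generated by `τ` and `k` further
elements (`exists_adjoin_of_pencil`).

Emptiness of `S^(j₀+1)` comes from a destabilizing one-parameter subgroup (`finrank_R_inf_T_le`). -/

/-! ### Krull dimension and transcendence degree. -/

theorem ringKrullDim_le_of_isIntegral {R S : Type*} [CommRing R] [CommRing S] (f : R →+* S)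
    (hf : f.IsIntegral) : ringKrullDim S ≤ ringKrullDim R := by
  algebraize [f]
  exact Order.krullDim_le_of_strictMono (PrimeSpectrum.comap (algebraMap R S))
    fun P Q hPQ => Ideal.IsIntegral.comap_lt_comap (I := P.asIdeal) (J := Q.asIdeal) hPQ

/-- Noether normalization: `B` is integral over a polynomial ring whose number of variables is at
most the transcendence degree. -/
theorem ringKrullDim_le_of_trdeg_le {k B : Type*} [Field k] [CommRing B] [IsDomain B] [Algebra k B]
    [Algebra.FiniteType k B] {d : ℕ} (h : Algebra.trdeg k B ≤ d) : ringKrullDim B ≤ d := by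
  obtain ⟨s, g, hg, hint⟩ := exists_integral_inj_algHom_of_fg k B
  refine (ringKrullDim_le_of_isIntegral g.toRingHom hint).trans ?_
  rw [MvPolynomial.ringKrullDim_of_isNoetherianRing, ringKrullDim_eq_zero_of_field, zero_add]
  have h1 := lift_trdeg_le_of_injective g hg
  rw [MvPolynomial.trdeg_of_isDomain] at h1
  have h2 : (s : Cardinal) ≤ Algebra.trdeg k B := by simpa using h1
  have h3 : s ≤ d := by exact_mod_cast h2.trans h
  rw [Nat.card_fin]
  exact_mod_cast h3

open scoped IntermediateField.algebraAdjoinAdjoin in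
theorem trdeg_adjoin_le {k L : Type*} [Field k] [Field L] [Algebra k L] (s : Finset L) :
    Algebra.trdeg k (IntermediateField.adjoin k (s : Set L)) ≤ s.card := by
  rw [← trdeg_add_eq k (Algebra.adjoin k (s : Set L)), trdeg_eq_zero (R := Algebra.adjoin k (s : Set L)),
    add_zero]
  let f : MvPolynomial (s : Set L) k →ₐ[k] L := MvPolynomial.aeval (fun i => (i : L))
  have hf : f.range = Algebra.adjoin k (s : Set L) := by
    rw [← Algebra.adjoin_range_eq_range_aeval, Subtype.range_coe]
  rw [← hf]
  have h := lift_trdeg_le_of_surjective f.rangeRestrict f.rangeRestrict_surjective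
  rw [MvPolynomial.trdeg_of_isDomain] at h
  simpa using h

/-- A finitely generated domain, embedded in a field generated by `d` elements, has Krull
dimension at most `d`. -/
theorem ringKrullDim_le_of_forall_mem_adjoin {k B L : Type*} [Field k] [CommRing B] [IsDomain B]
    [Algebra k B] [Algebra.FiniteType k B] [Field L] [Algebra k L] (f : B →ₐ[k] L)
    (hf : Function.Injective f) {d : ℕ} (s : Finset L) (hd : s.card ≤ d)
    (hs : ∀ b, f b ∈ IntermediateField.adjoin k (s : Set L)) : ringKrullDim B ≤ d := by
  refine ringKrullDim_le_of_trdeg_le (k := k) ?_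
  let g : B →ₐ[k] IntermediateField.adjoin k (s : Set L) :=
    f.codRestrict (IntermediateField.adjoin k (s : Set L)).toSubalgebra hs
  have hg : Function.Injective g := fun a b hab => hf (congrArg Subtype.val hab)
  have h1 := (lift_trdeg_le_of_injective g hg).trans (Cardinal.lift_le.mpr (trdeg_adjoin_le s))
  have h2 : Algebra.trdeg k B ≤ s.card := by simpa using h1
  exact h2.trans (by exact_mod_cast hd)

/-! ### Generic points of the degeneracy locus of a pencil. -/

section Pencil

variable {V W : Type*} [AddCommGroup V] [Module ℂ V] [FiniteDimensional ℂ V]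
  [AddCommGroup W] [Module ℂ W]

/-- A linear map of corank at most `k` has a right inverse up to an endomorphism whose image is
spanned by `k` vectors. -/
theorem exists_rightInverse_add (b : W →ₗ[ℂ] V) {k : ℕ}
    (hb : Module.finrank ℂ V ≤ Module.finrank ℂ (LinearMap.range b) + k) :
    ∃ (C : Finset V) (s : V →ₗ[ℂ] W) (r : V →ₗ[ℂ] V), C.card ≤ k ∧
      (∀ v, r v ∈ Submodule.span ℂ (C : Set V)) ∧ ∀ v, b (s v) + r v = v := by
  classical
  obtain ⟨Q, hQ⟩ := Submodule.exists_isCompl (LinearMap.range b)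
  obtain ⟨t, ht⟩ := b.rangeRestrict.exists_rightInverse_of_surjective b.range_rangeRestrict
  have hdim := Submodule.finrank_add_eq_of_isCompl hQ
  let e := Module.finBasis ℂ Q
  refine ⟨Finset.univ.image fun i => (e i : V), t ∘ₗ Submodule.projectionOnto _ Q hQ,
    Q.subtype ∘ₗ Submodule.projectionOnto Q _ hQ.symm, ?_, fun v => ?_, fun v => ?_⟩
  · refine Finset.card_image_le.trans ?_
    rw [Finset.card_univ, Fintype.card_fin]
    omega
  · have h : (Submodule.projectionOnto Q _ hQ.symm v : Q) ∈ Submodule.span ℂ (Set.range e) := by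
      rw [e.span_eq]; trivial
    have h2 := Submodule.mem_map_of_mem (f := Q.subtype) h
    rw [Submodule.map_span, ← Set.range_comp] at h2
    simpa [← Set.range_comp, Function.comp_def] using h2
  · have h1 := LinearMap.congr_fun ht (Submodule.projectionOnto _ Q hQ v)
    have h2 := congrArg Subtype.val h1
    simp only [LinearMap.comp_apply, LinearMap.id_apply, LinearMap.codRestrict_apply] at h2
    simp only [LinearMap.comp_apply, Submodule.subtype_apply, h2]
    exact Submodule.projection_add_projection_eq_self hQ v

variable {L : Type*} [Field L] [Algebra ℂ L]

omit [FiniteDimensional ℂ V] in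
theorem apply_mem_adjoin_of_mem_span (x : V →ₗ[ℂ] L) (C : Finset V) {s : Set L}
    (hC : ∀ c ∈ C, x c ∈ s) {v : V} (hv : v ∈ Submodule.span ℂ (C : Set V)) :
    x v ∈ IntermediateField.adjoin ℂ s := by
  have : Submodule.span ℂ (C : Set V) ≤
      (IntermediateField.adjoin ℂ s).toSubalgebra.toSubmodule.comap x :=
    Submodule.span_le.mpr fun c hc => IntermediateField.subset_adjoin ℂ s (hC c hc)
  exact this hv

/-- Here `x` factors through the cokernel of `b`, so `k` values suffice; `k + 1` is stated to match
the transcendental case. -/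
theorem exists_adjoin_of_comp_eq_zero (b : W →ₗ[ℂ] V) (x : V →ₗ[ℂ] L) (hx : ∀ w, x (b w) = 0)
    {k : ℕ} (hb : Module.finrank ℂ V ≤ Module.finrank ℂ (LinearMap.range b) + k) :
    ∃ s : Finset L, s.card ≤ k + 1 ∧ ∀ v, x v ∈ IntermediateField.adjoin ℂ (s : Set L) := by
  classical
  obtain ⟨C, s, r, hC, hr, h⟩ := exists_rightInverse_add b hb
  refine ⟨C.image x, (Finset.card_image_le.trans hC).trans (Nat.le_succ k), fun v => ?_⟩
  have hv : x v = x (r v) := by rw [← h v, map_add, hx, zero_add, h v]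
  rw [hv]
  exact apply_mem_adjoin_of_mem_span x C (fun c hc => by simpa using ⟨c, hc, rfl⟩) (hr v)

/-- If `x ∘ b₁ = τ • x ∘ b₀`, with `b₁` of corank at most `k` and `τ` transcendental, then the
values of `x` lie in a field generated by `τ` and `k` further elements. -/
theorem exists_adjoin_of_transcendental (b₀ b₁ : W →ₗ[ℂ] V) (x : V →ₗ[ℂ] L) {τ : L}
    (hτ : Transcendental ℂ τ) (hx : ∀ w, x (b₁ w) = τ * x (b₀ w))
    {k : ℕ} (hb : Module.finrank ℂ V ≤ Module.finrank ℂ (LinearMap.range b₁) + k) :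
    ∃ s : Finset L, s.card ≤ k + 1 ∧ ∀ v, x v ∈ IntermediateField.adjoin ℂ (s : Set L) := by
  classical
  obtain ⟨C, s, r, hC, hr, h⟩ := exists_rightInverse_add b₁ hb
  refine ⟨insert τ (C.image x), (Finset.card_insert_le _ _).trans
    (Nat.succ_le_succ (Finset.card_image_le.trans hC)), ?_⟩
  set K := IntermediateField.adjoin ℂ ((insert τ (C.image x) : Finset L) : Set L)
  have hτK : τ ∈ K := IntermediateField.subset_adjoin _ _ (by simp)
  have hrK : ∀ v, x (r v) ∈ K := fun v =>
    apply_mem_adjoin_of_mem_span x C (fun c hc => by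
      simp only [Finset.coe_insert, Finset.coe_image]
      exact Or.inr ⟨c, hc, rfl⟩) (hr v)
  -- Substituting `b₁ ∘ s + r = id` into `x` gives `x = τ • x ∘ b₀ ∘ s + x ∘ r`. In coordinates this
  -- is the linear system `(1 - τ N) y = x ∘ r`, with right-hand side in `K`.
  let e := Module.finBasis ℂ V
  let N := (LinearMap.toMatrix e e (b₀ ∘ₗ s)).transpose
  let M : Matrix _ _ K := 1 - (⟨τ, hτK⟩ : K) • N.map (algebraMap ℂ K)
  let y : Fin (Module.finrank ℂ V) → L := fun i => x (e i)
  have hMap : M.map (algebraMap K L) = 1 - τ • N.map (algebraMap ℂ L) := by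
    ext i j
    simp only [M, Matrix.map_apply, Matrix.sub_apply, Matrix.smul_apply, smul_eq_mul, map_sub,
      map_mul, Matrix.one_apply]
    rw [← IsScalarTower.algebraMap_apply ℂ K L]
    split_ifs <;> simp
  have hdet : M.det ≠ 0 := by
    intro h0
    have h1 : (M.map (algebraMap K L)).det = 0 := by
      rw [← RingHom.mapMatrix_apply, ← RingHom.map_det, h0, map_zero]
    apply hτ
    -- The determinant is `N.charpolyRev` at `τ`; this polynomial has constant term `1`, so a
    -- transcendental `τ` is not a root.
    refine ⟨N.charpolyRev, fun hN => ?_, ?_⟩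
    · have := Matrix.eval_charpolyRev (M := N)
      rw [hN] at this
      simp at this
    · rw [Matrix.charpolyRev, AlgHom.map_det, ← h1, hMap]
      congr 1
      ext i j
      simp only [AlgHom.mapMatrix_apply, Matrix.map_apply, Matrix.sub_apply, Matrix.smul_apply,
        smul_eq_mul, map_sub, map_mul, Polynomial.aeval_X, Polynomial.aeval_C, Matrix.one_apply]
      split_ifs <;> simp
  have hMy : (M.map (algebraMap K L)).mulVec y = fun i => x (r (e i)) := by
    rw [hMap]
    ext i
    rw [Matrix.sub_mulVec, Matrix.one_mulVec, Matrix.smul_mulVec]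
    have h1 : b₀ (s (e i)) = ∑ j, N i j • e j := by
      conv_lhs => rw [← e.sum_repr (b₀ (s (e i)))]
      simp [N, LinearMap.toMatrix_apply]
    have h2 : x (e i) = τ * x (b₀ (s (e i))) + x (r (e i)) := by
      rw [← hx, ← map_add, h]
    rw [h1] at h2
    simp only [map_sum, map_smul, Algebra.smul_def] at h2
    simp only [Pi.sub_apply, Pi.smul_apply, smul_eq_mul, Matrix.mulVec, dotProduct, y,
      Matrix.map_apply]
    rw [h2]
    ring
  have hy : ∀ i, y i ∈ K := by
    intro i
    let z : Fin (Module.finrank ℂ V) → K := fun i => ⟨x (r (e i)), hrK (e i)⟩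
    have h1 : (M.map (algebraMap K L)).mulVec ((algebraMap K L) ∘ M⁻¹.mulVec z) =
        (M.map (algebraMap K L)).mulVec y := by
      have h3 : (M.map (algebraMap K L)).mulVec ((algebraMap K L) ∘ M⁻¹.mulVec z) =
          (algebraMap K L) ∘ M.mulVec (M⁻¹.mulVec z) :=
        funext fun i => ((algebraMap K L).map_mulVec M _ i).symm
      rw [hMy, h3, Matrix.mulVec_mulVec,
        Matrix.mul_nonsing_inv _ (isUnit_iff_ne_zero.mpr hdet), Matrix.one_mulVec]
      rfl
    have h2 := Matrix.mulVec_injective_of_isUnit (A := M.map (algebraMap K L)) (by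
      rw [Matrix.isUnit_iff_isUnit_det, ← RingHom.mapMatrix_apply, ← RingHom.map_det]
      exact (isUnit_iff_ne_zero.mpr hdet).map _) h1
    rw [← h2]
    exact (M⁻¹.mulVec z i).2
  intro v
  rw [← e.sum_repr v]
  simp only [map_sum, map_smul]
  exact sum_mem fun i _ => K.smul_mem (hy i)

/-- A generic point of the degeneracy locus of a pencil `s b₀ + t b₁` of linear maps, all of whose
nonzero members have corank at most `k`, is defined over a field generated by `k + 1` elements. -/
theorem exists_adjoin_of_pencil (b₀ b₁ : W →ₗ[ℂ] V) (x : V →ₗ[ℂ] L)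
    (hx : ∀ w w', x (b₀ w) * x (b₁ w') = x (b₀ w') * x (b₁ w)) {k : ℕ}
    (hb : ∀ s t : ℂ, (s ≠ 0 ∨ t ≠ 0) →
      Module.finrank ℂ V ≤ Module.finrank ℂ (LinearMap.range (s • b₀ + t • b₁)) + k) :
    ∃ s : Finset L, s.card ≤ k + 1 ∧ ∀ v, x v ∈ IntermediateField.adjoin ℂ (s : Set L) := by
  by_cases h0 : ∀ w, x (b₀ w) = 0
  · have h := hb 1 0 (by simp)
    rw [show (1 : ℂ) • b₀ + (0 : ℂ) • b₁ = b₀ by simp] at h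
    exact exists_adjoin_of_comp_eq_zero b₀ x h0 h
  push Not at h0
  obtain ⟨w₀, hw₀⟩ := h0
  set τ := x (b₁ w₀) / x (b₀ w₀) with hτ
  have hx' : ∀ w, x (b₁ w) = τ * x (b₀ w) := fun w => by
    rw [hτ]
    field_simp
    linear_combination hx w₀ w
  by_cases ht : Transcendental ℂ τ
  · have h := hb 0 1 (by simp)
    rw [show (0 : ℂ) • b₀ + (1 : ℂ) • b₁ = b₁ by simp] at h
    exact exists_adjoin_of_transcendental b₀ b₁ x ht hx' h
  -- Since `ℂ` is algebraically closed, `τ` is a constant `c`, and `x` kills the member `b₁ - c b₀`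
  -- of the pencil.
  · have halg : IsAlgebraic ℂ τ := not_not.mp ht
    have := IntermediateField.isAlgebraic_adjoin_simple halg.isIntegral
    obtain ⟨c, hc⟩ := IntermediateField.mem_bot.mp
      (IntermediateField.eq_bot_of_isAlgClosed_of_isAlgebraic (IntermediateField.adjoin ℂ {τ}) ▸
        IntermediateField.mem_adjoin_simple_self ℂ τ)
    refine exists_adjoin_of_comp_eq_zero (-c • b₀ + (1 : ℂ) • b₁) x (fun w => ?_)
      (hb _ _ (by simp))
    simp [hx', ← hc, Algebra.smul_def]

end Pencil

/-! ### Affine cones, their ideals and the dimension of projective sets. -/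

section Forms

variable {E : Type*} [AddCommGroup E] [Module ℂ E]

theorem evalForm_smul {p : MvPolynomial (Module.Dual ℂ E) ℂ} {d : ℕ} (hp : p.IsHomogeneous d)
    (c : ℂ) (e : E) : evalForm p (c • e) = c ^ d * evalForm p e := by
  simp only [evalForm, MvPolynomial.eval_eq, Finset.mul_sum]
  refine Finset.sum_congr rfl fun s hs => ?_
  have h := hp (MvPolynomial.mem_support_iff.mp hs)
  rw [Finsupp.weight_apply, Finsupp.sum] at h
  simp only [map_smul, smul_eq_mul, mul_pow, Finset.prod_mul_distrib, Finset.prod_pow_eq_pow_sum]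
  rw [← h]
  simp only [Pi.one_apply, smul_eq_mul, mul_one]
  ring

theorem evalForm_rep_mk_eq_zero_iff {p : MvPolynomial (Module.Dual ℂ E) ℂ} {d : ℕ}
    (hp : p.IsHomogeneous d) {e : E} (he : e ≠ 0) :
    evalForm p (Projectivization.mk ℂ e he).rep = 0 ↔ evalForm p e = 0 := by
  obtain ⟨a, ha⟩ := Projectivization.exists_smul_eq_mk_rep ℂ e he
  rw [← ha, Units.smul_def, evalForm_smul hp]
  simp

theorem evalForm_line (p : MvPolynomial (Module.Dual ℂ E) ℂ) (e u : E) :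
    ∃ q : Polynomial ℂ, ∀ t, q.eval t = evalForm p (e + t • u) := by
  refine ⟨MvPolynomial.aeval (fun l => Polynomial.C (l e) + Polynomial.X * Polynomial.C (l u)) p,
    fun t => ?_⟩
  induction p using MvPolynomial.induction_on with
  | C a => simp [evalForm]
  | add p q hp hq => simp_all [evalForm]
  | mul_X p l hp =>
    simp_all [evalForm]
    exact Or.inl (mul_comm _ _)

theorem evalForm_smul_eq_sum (p : MvPolynomial (Module.Dual ℂ E) ℂ) (t : ℂ) (e : E) :
    evalForm p (t • e) = ∑ i ∈ Finset.range (p.totalDegree + 1),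
      t ^ i * evalForm (MvPolynomial.homogeneousComponent i p) e := by
  conv_lhs => rw [← MvPolynomial.sum_homogeneousComponent p, evalForm, map_sum]
  exact Finset.sum_congr rfl fun i _ =>
    evalForm_smul (MvPolynomial.homogeneousComponent_isHomogeneous i p) t e

theorem evalForm_homogeneousComponent_eq_zero {p : MvPolynomial (Module.Dual ℂ E) ℂ} {e : E}
    (h : ∀ t : ℂ, evalForm p (t • e) = 0) (d : ℕ) :
    evalForm (MvPolynomial.homogeneousComponent d p) e = 0 := by
  let q : Polynomial ℂ := ∑ i ∈ Finset.range (p.totalDegree + 1),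
    Polynomial.monomial i (evalForm (MvPolynomial.homogeneousComponent i p) e)
  have hq : q = 0 := by
    refine Polynomial.funext fun t => ?_
    rw [Polynomial.eval_zero, ← h t, evalForm_smul_eq_sum]
    simp only [q, Polynomial.eval_finsetSum, Polynomial.eval_monomial, mul_comm]
  by_cases hd : d < p.totalDegree + 1
  · have := congrArg (Polynomial.coeff · d) hq
    simpa [q, Polynomial.finsetSum_coeff, Polynomial.coeff_monomial, hd] using this
  · rw [MvPolynomial.homogeneousComponent_eq_zero _ _ (by omega)]
    simp [evalForm]

theorem evalForm_eq_zero_of_homogeneousComponent {p : MvPolynomial (Module.Dual ℂ E) ℂ} {e : E}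
    (h : ∀ d, evalForm (MvPolynomial.homogeneousComponent d p) e = 0) (t : ℂ) :
    evalForm p (t • e) = 0 := by
  rw [evalForm_smul_eq_sum]
  exact Finset.sum_eq_zero fun i _ => by rw [h, mul_zero]

theorem isClosed_iff_isZariskiClosed {Z : Set (ℙ ℂ E)} :
    @IsClosed _ (zariskiTopology E) Z ↔ IsZariskiClosed Z := by
  rw [← @isOpen_compl_iff _ _ (zariskiTopology E)]
  change Zᶜᶜ ∈ {Z | IsZariskiClosed Z} ↔ _
  rw [compl_compl]
  rfl

/-- The ideal of the affine cone over a subset of `ℙ(E)`. -/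
noncomputable def coneIdeal (Y : Set (ℙ ℂ E)) : Ideal (MvPolynomial (Module.Dual ℂ E) ℂ) where
  carrier := {p | ∀ x ∈ Y, ∀ t : ℂ, evalForm p (t • x.rep) = 0}
  zero_mem' := fun x _ t => by simp [evalForm]
  add_mem' := fun {p q} hp hq x hx t => by
    have h1 := hp x hx t
    have h2 := hq x hx t
    simp only [evalForm, map_add] at h1 h2 ⊢
    rw [h1, h2, add_zero]
  smul_mem' := fun c p hp x hx t => by
    have h1 := hp x hx t
    simp only [evalForm, smul_eq_mul, map_mul] at h1 ⊢
    rw [h1, mul_zero]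

theorem mem_coneIdeal {Y : Set (ℙ ℂ E)} {p : MvPolynomial (Module.Dual ℂ E) ℂ} :
    p ∈ coneIdeal Y ↔ ∀ x ∈ Y, ∀ t : ℂ, evalForm p (t • x.rep) = 0 := Iff.rfl

theorem coneIdeal_anti {Y Z : Set (ℙ ℂ E)} (h : Y ⊆ Z) : coneIdeal Z ≤ coneIdeal Y :=
  fun _ hp x hx t => hp x (h hx) t

/-- The cone ideal recovers the Zariski closure; this makes `coneIdeal` strictly monotone on chains
of closed sets. -/
theorem zeroLocus_subset_of_coneIdeal_le {Y : Set (ℙ ℂ E)}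
    {F : Set (MvPolynomial (Module.Dual ℂ E) ℂ)} (hF : ∀ p ∈ F, ∃ d : ℕ, p.IsHomogeneous d)
    (hY : Y ⊆ zeroLocus F) {Z : Set (ℙ ℂ E)} (h : coneIdeal Y ≤ coneIdeal Z) :
    Z ⊆ zeroLocus F := by
  intro x hx p hp
  obtain ⟨d, hd⟩ := hF p hp
  have : p ∈ coneIdeal Y := fun y hy t => by
    rw [evalForm_smul hd, hY hy p hp, mul_zero]
  simpa using h this x hx 1

theorem coneIdeal_isPrime {Y : Set (ℙ ℂ E)} (hY : @IsIrreducible _ (zariskiTopology E) Y) :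
    (coneIdeal Y).IsPrime := by
  let := zariskiTopology E
  have hopen : ∀ p : MvPolynomial (Module.Dual ℂ E) ℂ,
      IsOpen {x : ℙ ℂ E | ∃ t : ℂ, evalForm p (t • x.rep) ≠ 0} := by
    intro p
    rw [← isClosed_compl_iff, isClosed_iff_isZariskiClosed]
    refine ⟨Set.range fun d => MvPolynomial.homogeneousComponent d p, ?_, ?_⟩
    · rintro _ ⟨d, rfl⟩
      exact ⟨d, MvPolynomial.homogeneousComponent_isHomogeneous d p⟩
    · ext x
      simp only [Set.mem_compl_iff, Set.mem_ofPred_eq, not_exists, not_not, zeroLocus,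
        Set.forall_mem_range]
      exact ⟨evalForm_homogeneousComponent_eq_zero, evalForm_eq_zero_of_homogeneousComponent⟩
  refine Ideal.isPrime_iff.mpr ⟨fun htop => ?_, fun {p q} hpq => ?_⟩
  · obtain ⟨x, hx⟩ := hY.nonempty
    have h1 : (1 : MvPolynomial (Module.Dual ℂ E) ℂ) ∈ coneIdeal Y := htop ▸ Submodule.mem_top
    simpa [evalForm] using h1 x hx 1
  · by_contra! hcon
    simp only [mem_coneIdeal, not_forall] at hcon
    obtain ⟨⟨x, hx, s, hs⟩, y, hy, t, ht⟩ := hcon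
    obtain ⟨z, hz, ⟨s', hs'⟩, t', ht'⟩ := hY.isPreirreducible _ _ (hopen p) (hopen q)
      ⟨x, hx, s, hs⟩ ⟨y, hy, t, ht⟩
    -- Neither `p` nor `q` vanishes on the whole line through `z`, so their restrictions are nonzero
    -- polynomials in one variable with product zero.
    obtain ⟨f, hf⟩ := evalForm_line p 0 z.rep
    obtain ⟨g, hg⟩ := evalForm_line q 0 z.rep
    simp only [zero_add] at hf hg
    have hf0 : f ≠ 0 := fun h => hs' (by rw [← hf, h, Polynomial.eval_zero])
    have hg0 : g ≠ 0 := fun h => ht' (by rw [← hg, h, Polynomial.eval_zero])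
    refine mul_ne_zero hf0 hg0 (Polynomial.funext fun r => ?_)
    have h := hpq z hz r
    rw [Polynomial.eval_mul, hf, hg, Polynomial.eval_zero, ← h]
    simp [evalForm]

/-- The ideal of the vertex of the affine cone. -/
noncomputable def vertexIdeal (E : Type*) [AddCommGroup E] [Module ℂ E] :
    Ideal (MvPolynomial (Module.Dual ℂ E) ℂ) :=
  RingHom.ker (MvPolynomial.eval (0 : Module.Dual ℂ E → ℂ))

theorem coneIdeal_lt_vertexIdeal {Y : Set (ℙ ℂ E)} (hY : Y.Nonempty) :
    coneIdeal Y < vertexIdeal E := by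
  obtain ⟨x, hx⟩ := hY
  refine lt_of_le_of_ne (fun p hp => ?_) fun h => ?_
  · have := hp x hx 0
    rw [zero_smul] at this
    exact RingHom.mem_ker.mpr (by simpa [evalForm] using this)
  · obtain ⟨l, hl⟩ : ∃ l : Module.Dual ℂ E, l x.rep ≠ 0 := by
      by_contra! hcon
      exact x.rep_nonzero ((Module.forall_dual_apply_eq_zero_iff ℂ _).mp hcon)
    have h1 : (MvPolynomial.X l : MvPolynomial (Module.Dual ℂ E) ℂ) ∈ vertexIdeal E := by
      simp [vertexIdeal]
    rw [← h] at h1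
    exact hl (by simpa [evalForm] using h1 x hx 1)

/-- The class of a linear form in the homogeneous coordinate ring of a subset of `ℙ(E)`. -/
noncomputable def coordinate (Y : Set (ℙ ℂ E)) :
    Module.Dual ℂ E →ₗ[ℂ] MvPolynomial (Module.Dual ℂ E) ℂ ⧸ coneIdeal Y where
  toFun l := Ideal.Quotient.mk _ (MvPolynomial.X l)
  map_add' l l' := by
    rw [← map_add, Ideal.Quotient.eq]
    intro x _ t
    simp only [evalForm, map_sub, map_add, MvPolynomial.eval_X, LinearMap.add_apply]
    ring
  map_smul' c l := by
    rw [RingHom.id_apply, ← Ideal.Quotient.mkₐ_eq_mk ℂ, ← map_smul, Ideal.Quotient.mkₐ_eq_mk,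
      Ideal.Quotient.eq]
    intro x _ t
    simp only [evalForm, map_sub, map_mul, MvPolynomial.eval_X, LinearMap.smul_apply,
      MvPolynomial.smul_eq_C_mul, MvPolynomial.eval_C, smul_eq_mul]
    ring

theorem range_le_of_coordinate_mem (Y : Set (ℙ ℂ E)) {A : Type*} [CommRing A] [Algebra ℂ A]
    (f : (MvPolynomial (Module.Dual ℂ E) ℂ ⧸ coneIdeal Y) →ₐ[ℂ] A) (K : Subalgebra ℂ A)
    (h : ∀ l, f (coordinate Y l) ∈ K) (b) : f b ∈ K := by
  obtain ⟨p, rfl⟩ := Ideal.Quotient.mk_surjective b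
  induction p using MvPolynomial.induction_on with
  | C a =>
    have : (Ideal.Quotient.mk (coneIdeal Y) (MvPolynomial.C a)) = algebraMap ℂ _ a := rfl
    rw [this, AlgHom.commutes]
    exact K.algebraMap_mem a
  | add p q hp hq => rw [map_add, map_add]; exact K.add_mem hp hq
  | mul_X p l hp => rw [map_mul, map_mul]; exact K.mul_mem hp (h l)

/-- The polynomial ring has one variable for each functional, but linear relations among functionals
lie in the cone ideal, so a basis of the dual generates. -/
instance [FiniteDimensional ℂ E] (Y : Set (ℙ ℂ E)) :
    Algebra.FiniteType ℂ (MvPolynomial (Module.Dual ℂ E) ℂ ⧸ coneIdeal Y) := by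
  classical
  let e := Module.finBasis ℂ (Module.Dual ℂ E)
  refine ⟨⟨Finset.univ.image fun i => coordinate Y (e i), ?_⟩⟩
  refine Algebra.eq_top_iff.mpr (range_le_of_coordinate_mem Y (AlgHom.id ℂ _) _ fun l => ?_)
  rw [AlgHom.id_apply, ← e.sum_repr l, map_sum]
  refine sum_mem fun i _ => ?_
  rw [map_smul]
  exact Subalgebra.smul_mem _ (Algebra.subset_adjoin (by simp)) _

/-- Krull dimension of a subset of `ℙ(E)` is bounded via the homogeneous coordinate rings. -/
theorem zariskiDim_le {Y : Set (ℙ ℂ E)} {k : ℕ}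
    (h : ∀ Z ⊆ Y, @IsIrreducible _ (zariskiTopology E) Z →
      ringKrullDim (MvPolynomial (Module.Dual ℂ E) ℂ ⧸ coneIdeal Z) ≤ (k + 1 : ℕ)) :
    zariskiDim Y ≤ k := by
  let := zariskiTopology E
  change Order.krullDim (TopologicalSpace.IrreducibleCloseds Y) ≤ k
  rw [Order.krullDim_eq_iSup_height]
  refine iSup_le fun a => ?_
  rw [Order.height_eq_krullDim_Iic]
  let im : TopologicalSpace.IrreducibleCloseds Y → Set (ℙ ℂ E) := fun Z => Subtype.val '' (Z : Set Y)
  have hirr : ∀ Z, IsIrreducible (im Z) := fun Z =>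
    Z.isIrreducible.image _ continuous_subtype_val.continuousOn
  have hmono : ∀ Z Z' : TopologicalSpace.IrreducibleCloseds Y, Z < Z' →
      coneIdeal (im Z') < coneIdeal (im Z) := by
    intro Z Z' hZ
    refine lt_of_le_not_ge (coneIdeal_anti (Set.image_mono hZ.le)) fun hle => hZ.not_ge ?_
    obtain ⟨C, hC, hCZ⟩ := isClosed_induced_iff.mp Z.isClosed
    obtain ⟨F, hF, rfl⟩ := isClosed_iff_isZariskiClosed.mp hC
    have h1 : im Z ⊆ zeroLocus F := by
      rintro _ ⟨y, hy, rfl⟩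
      rw [← hCZ] at hy
      exact hy
    have h2 := zeroLocus_subset_of_coneIdeal_le hF h1 hle
    intro y hy
    have h3 : y ∈ (Z : Set Y) := hCZ ▸ h2 ⟨y, hy, rfl⟩
    exact h3
  -- A chain of irreducible closed sets becomes a reversed chain of cone primes. The added bottom
  -- element goes to the vertex ideal, which accounts for the cone having one dimension more.
  let φ : WithBot (Set.Iic a) → (PrimeSpectrum.zeroLocus (coneIdeal (im a) : Set
      (MvPolynomial (Module.Dual ℂ E) ℂ)))ᵒᵈ := fun Z =>
    OrderDual.toDual (Z.recBotCoe
      ⟨⟨vertexIdeal E, RingHom.ker_isPrime _⟩, (coneIdeal_lt_vertexIdeal (hirr a).nonempty).le⟩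
      fun Z => ⟨⟨coneIdeal (im Z), coneIdeal_isPrime (hirr Z)⟩, coneIdeal_anti (Set.image_mono Z.2)⟩)
  have hφ : StrictMono φ := by
    intro Z Z' hZ
    induction Z' using WithBot.recBotCoe with
    | bot => exact absurd hZ (not_lt_bot)
    | coe Z' =>
      induction Z using WithBot.recBotCoe with
      | bot => exact coneIdeal_lt_vertexIdeal (hirr Z').nonempty
      | coe Z => exact hmono Z Z' (show Z < Z' from WithBot.coe_lt_coe.mp hZ)
  have h1 := Order.krullDim_le_of_strictMono φ hφ
  rw [Order.krullDim_orderDual, ← ringKrullDim_quotient] at h1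
  have : Nonempty (Set.Iic a) := ⟨⟨a, Set.mem_Iic.mpr le_rfl⟩⟩
  rw [Order.krullDim_withBot] at h1
  have h2 := h1.trans (h (im a) (by rintro _ ⟨y, -, rfl⟩; exact y.2) (hirr a))
  rw [← Order.height_eq_krullDim_Iic] at h2 ⊢
  have h3 : Order.height a + 1 ≤ (k : ℕ∞) + 1 := by exact_mod_cast h2
  have h4 : Order.height a ≤ (k : ℕ∞) := (ENat.add_le_add_iff_right (by simp)).mp h3
  exact_mod_cast h4

end Forms

/-! ### Linear subvarieties. -/

section Linear

variable {E : Type*} [AddCommGroup E] [Module ℂ E]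

/-- The linear subvariety of `ℙ(E)` defined by a subspace of `E`. -/
def linearLocus (U : Submodule ℂ E) : Set (ℙ ℂ E) := {x | x.rep ∈ U}

theorem mk_mem_linearLocus {U : Submodule ℂ E} {e : E} (he : e ≠ 0) :
    Projectivization.mk ℂ e he ∈ linearLocus U ↔ e ∈ U := by
  obtain ⟨a, ha⟩ := Projectivization.exists_smul_eq_mk_rep ℂ e he
  rw [linearLocus, Set.mem_ofPred_eq, ← ha]
  exact U.smul_mem_iff_of_isUnit a.isUnit

theorem isZariskiClosed_linearLocus (U : Submodule ℂ E) : IsZariskiClosed (linearLocus U) := by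
  refine ⟨MvPolynomial.X '' (U.dualAnnihilator : Set (Module.Dual ℂ E)), ?_, ?_⟩
  · rintro _ ⟨l, -, rfl⟩
    exact ⟨1, MvPolynomial.isHomogeneous_X ℂ l⟩
  · ext x
    simp only [zeroLocus, Set.forall_mem_image, Set.mem_ofPred_eq, evalForm, MvPolynomial.eval_X]
    exact (Subspace.forall_mem_dualAnnihilator_apply_eq_zero_iff U x.rep).symm

/-- Two nonempty open subsets are met at a general point of the line joining a point of one to a
point of the other. -/
theorem isIrreducible_linearLocus {U : Submodule ℂ E} (hU : U ≠ ⊥) :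
    @IsIrreducible _ (zariskiTopology E) (linearLocus U) := by
  let := zariskiTopology E
  obtain ⟨e, heU, he⟩ := U.exists_mem_ne_zero_of_ne_bot hU
  refine ⟨⟨_, (mk_mem_linearLocus he).mpr heU⟩, ?_⟩
  have hopen : ∀ O : Set (ℙ ℂ E), IsOpen O → ∀ x ∈ O, ∃ p : MvPolynomial (Module.Dual ℂ E) ℂ,
      (∃ d, p.IsHomogeneous d) ∧ evalForm p x.rep ≠ 0 ∧
      ∀ (e : E) (he : e ≠ 0), evalForm p e ≠ 0 → Projectivization.mk ℂ e he ∈ O := by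
    intro O hO x hx
    obtain ⟨F, hF, hFO⟩ := isClosed_iff_isZariskiClosed.mp hO.isClosed_compl
    have hx' : x ∉ zeroLocus F := hFO ▸ fun h => h hx
    simp only [zeroLocus, Set.mem_ofPred_eq, not_forall] at hx'
    obtain ⟨p, hp, hpx⟩ := hx'
    refine ⟨p, hF p hp, hpx, fun e he hpe => ?_⟩
    by_contra hcon
    have h1 : Projectivization.mk ℂ e he ∈ zeroLocus F := hFO ▸ hcon
    obtain ⟨d, hd⟩ := hF p hp
    exact hpe ((evalForm_rep_mk_eq_zero_iff hd he).mp (h1 p hp))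
  rintro O O' hO hO' ⟨x, hxU, hx⟩ ⟨y, hyU, hy⟩
  obtain ⟨p, -, hpx, hp⟩ := hopen O hO x hx
  obtain ⟨q, -, hqy, hq⟩ := hopen O' hO' y hy
  -- The functional `l` serves to keep the chosen vector on the line nonzero.
  obtain ⟨l, hl⟩ : ∃ l : Module.Dual ℂ E, l x.rep ≠ 0 := by
    by_contra! hcon
    exact x.rep_nonzero ((Module.forall_dual_apply_eq_zero_iff ℂ _).mp hcon)
  obtain ⟨f, hf⟩ := evalForm_line p x.rep (y.rep - x.rep)
  obtain ⟨g, hg⟩ := evalForm_line q x.rep (y.rep - x.rep)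
  obtain ⟨h, hh⟩ := evalForm_line (MvPolynomial.X l) x.rep (y.rep - x.rep)
  have hf0 : f ≠ 0 := fun h0 => hpx (by simpa [h0] using (hf 0).symm)
  have hg0 : g ≠ 0 := fun h0 => hqy (by simpa [h0] using (hg 1).symm)
  have hh0 : h ≠ 0 := fun h0 => hl (by simpa [h0, evalForm] using (hh 0).symm)
  obtain ⟨t, ht⟩ : ∃ t, (f * g * h).eval t ≠ 0 := by
    by_contra! hcon
    exact mul_ne_zero (mul_ne_zero hf0 hg0) hh0
      (Polynomial.funext fun r => by rw [hcon, Polynomial.eval_zero])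
  simp only [Polynomial.eval_mul, hf, hg, hh, mul_ne_zero_iff] at ht
  obtain ⟨⟨htf, htg⟩, hth⟩ := ht
  have hne : x.rep + t • (y.rep - x.rep) ≠ 0 := fun h0 => hth (by simp [h0, evalForm])
  refine ⟨Projectivization.mk ℂ _ hne, (mk_mem_linearLocus hne).mpr ?_, hp _ hne htf, hq _ hne htg⟩
  exact U.add_mem hxU (U.smul_mem _ (U.sub_mem hyU hxU))

/-- A partial flag spanned by initial segments of a basis of `U` gives a chain of length `k`. -/
theorem le_zariskiDim_of_linearLocus_subset [FiniteDimensional ℂ E] {Y : Set (ℙ ℂ E)}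
    {U : Submodule ℂ E} (hUY : linearLocus U ⊆ Y) {k : ℕ} (hk : k + 1 ≤ Module.finrank ℂ U) :
    ((k : ℕ∞) : WithBot ℕ∞) ≤ zariskiDim Y := by
  let := zariskiTopology E
  change _ ≤ Order.krullDim (TopologicalSpace.IrreducibleCloseds Y)
  let e : Fin (k + 1) → E := fun i => Module.finBasis ℂ U (Fin.castLE hk i)
  have he : LinearIndependent ℂ e :=
    ((Module.finBasis ℂ U).linearIndependent.map' U.subtype U.ker_subtype).comp _
      (Fin.castLE_injective hk)
  let F : Fin (k + 1) → Submodule ℂ E := fun i => Submodule.span ℂ (e '' Set.Iic i)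
  have hF : ∀ i j, e i ∈ F j ↔ i ≤ j := by
    intro i j
    refine ⟨fun h => ?_, fun h => Submodule.subset_span ⟨i, h, rfl⟩⟩
    by_contra hij
    exact he.notMem_span_image hij h
  have hFU : ∀ i, linearLocus (F i) ⊆ Y := by
    refine fun i => Set.Subset.trans (fun x hx => ?_) hUY
    refine (Submodule.span_le.mpr ?_ : F i ≤ U) hx
    rintro _ ⟨j, -, rfl⟩
    exact (Module.finBasis ℂ U (Fin.castLE hk j)).2
  have hirr : ∀ i, IsIrreducible (Subtype.val ⁻¹' linearLocus (F i) : Set Y) := by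
    intro i
    have h1 : IsIrreducible (linearLocus (F i)) := isIrreducible_linearLocus fun h => by
      have := (hF i i).mpr le_rfl
      rw [h, Submodule.mem_bot] at this
      exact he.ne_zero i this
    refine ⟨?_, ?_⟩
    · obtain ⟨x, hx⟩ := h1.nonempty
      exact ⟨⟨x, hFU i hx⟩, hx⟩
    · rintro _ _ ⟨O, hO, rfl⟩ ⟨O', hO', rfl⟩ ⟨x, hx, hxO⟩ ⟨y, hy, hyO⟩
      obtain ⟨z, hz, hzO⟩ := h1.isPreirreducible O O' hO hO' ⟨x, hx, hxO⟩ ⟨y, hy, hyO⟩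
      exact ⟨⟨z, hFU i hz⟩, hz, hzO⟩
  let φ : Fin (k + 1) → TopologicalSpace.IrreducibleCloseds Y := fun i =>
    ⟨_, hirr i, (isClosed_iff_isZariskiClosed.mpr (isZariskiClosed_linearLocus (F i))).preimage
      continuous_subtype_val⟩
  have hφ : StrictMono φ := by
    intro i j hij
    refine lt_of_le_not_ge (fun x hx => ?_) fun hle => ?_
    · exact (Submodule.span_mono (Set.image_mono (Set.Iic_subset_Iic.mpr hij.le)) : F i ≤ F j) hx
    · have h1 := (mk_mem_linearLocus (he.ne_zero j)).mpr ((hF j j).mpr le_rfl)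
      have h2 : (⟨_, hFU j h1⟩ : Y) ∈ φ i := hle h1
      exact hij.not_ge ((hF j i).mp ((mk_mem_linearLocus (he.ne_zero j)).mp h2))
  exact Order.LTSeries.length_le_krullDim (LTSeries.mk k φ hφ)

theorem nonempty_of_zariskiDim_nonneg {Y : Set (ℙ ℂ E)} (h : 0 ≤ zariskiDim Y) : Y.Nonempty := by
  let := zariskiTopology E
  obtain ⟨Z⟩ := Order.krullDim_nonneg_iff.mp h
  obtain ⟨y, -⟩ := Z.isIrreducible.nonempty
  exact ⟨y.1, y.2⟩

end Linear

/-! ### Slices of the tensor and the degeneracy locus. -/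

section Slices

variable {I V W : Type*} [AddCommGroup I] [Module ℂ I] [AddCommGroup V] [Module ℂ V]
  [AddCommGroup W] [Module ℂ W]

/-- Contraction of the first tensor factor with a linear form. -/
noncomputable def contract (V : Type*) [AddCommGroup V] [Module ℂ V] (φ : Module.Dual ℂ I) :
    I ⊗[ℂ] V →ₗ[ℂ] V :=
  (TensorProduct.lid ℂ V).toLinearMap ∘ₗ LinearMap.rTensor V φ

@[simp]
theorem contract_tmul (φ : Module.Dual ℂ I) (i : I) (v : V) :
    contract V φ (i ⊗ₜ[ℂ] v) = φ i • v := by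
  simp [contract]

theorem contract_add (φ ψ : Module.Dual ℂ I) (s t : ℂ) :
    contract V (s • φ + t • ψ) = s • contract V φ + t • contract V ψ := by
  ext i v
  simp [add_smul, mul_smul]

theorem contract_map (φ : Module.Dual ℂ I) (g : I →ₗ[ℂ] I) (z : I ⊗[ℂ] V) :
    contract V φ (TensorProduct.map g LinearMap.id z) = contract V (φ ∘ₗ g) z := by
  induction z using TensorProduct.induction_on with
  | zero => simp
  | tmul i v => simp
  | add x y hx hy => rw [map_add, map_add, map_add, hx, hy]

theorem fiberMap_eq_contract (B : W →ₗ[ℂ] I ⊗[ℂ] V) (ξ : Module.Dual ℂ V) (φ : Module.Dual ℂ I)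
    (w : W) : fiberMap B ξ φ w = ξ (contract V φ (B w)) := by
  rw [fiberMap_apply]
  generalize B w = z
  induction z using TensorProduct.induction_on with
  | zero => simp
  | tmul i v => simp
  | add x y hx hy => rw [map_add, map_add, map_add, hx, hy]

theorem exists_dual_ne_zero_apply_eq_zero [FiniteDimensional ℂ I] (hI : Module.finrank ℂ I = 2)
    (ω : I) : ∃ φ : Module.Dual ℂ I, φ ≠ 0 ∧ φ ω = 0 := by
  have h : LinearMap.ker (Module.Dual.eval ℂ I ω) ≠ ⊥ := by
    refine LinearMap.ker_ne_bot_of_finrank_lt ?_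
    rw [Module.finrank_self, Subspace.dual_finrank_eq, hI]
    exact one_lt_two
  obtain ⟨φ, hφ, hφ0⟩ := Submodule.exists_mem_ne_zero_of_ne_bot h
  exact ⟨φ, hφ0, hφ⟩

theorem exists_ne_zero_dual_apply_eq_zero [FiniteDimensional ℂ I] (hI : Module.finrank ℂ I = 2)
    (φ : Module.Dual ℂ I) : ∃ ω : I, ω ≠ 0 ∧ φ ω = 0 := by
  have h : LinearMap.ker φ ≠ ⊥ := by
    refine LinearMap.ker_ne_bot_of_finrank_lt ?_
    rw [Module.finrank_self, hI]
    exact one_lt_two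
  obtain ⟨ω, hω, hω0⟩ := Submodule.exists_mem_ne_zero_of_ne_bot h
  exact ⟨ω, hω0, hω⟩

theorem ker_contract [FiniteDimensional ℂ I] (hI : Module.finrank ℂ I = 2) {φ : Module.Dual ℂ I}
    (hφ : φ ≠ 0) {ω : I} (hω : ω ≠ 0) (h : φ ω = 0) : LinearMap.ker (contract V φ) = R V ω := by
  obtain ⟨i, hi⟩ : ∃ i, φ i = 1 := by
    obtain ⟨i, hi⟩ : ∃ i, φ i ≠ 0 := by
      by_contra! hcon
      exact hφ (LinearMap.ext hcon)
    exact ⟨(φ i)⁻¹ • i, by simp [hi]⟩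
  have hker : Module.finrank ℂ (LinearMap.ker φ) = 1 := by
    have h1 := LinearMap.finrank_range_add_finrank_ker φ
    rw [LinearMap.range_eq_top.mpr (fun c => ⟨c • i, by simp [hi]⟩), finrank_top,
      Module.finrank_self, hI] at h1
    omega
  have hspan : ∀ a : I, ∃ c : ℂ, a = c • ω + φ a • i := by
    intro a
    obtain ⟨c, hc⟩ := (finrank_eq_one_iff_of_nonzero' (⟨ω, h⟩ : LinearMap.ker φ)
      (fun h0 => hω (congrArg Subtype.val h0))).mp hker ⟨a - φ a • i, by simp [hi]⟩
    refine ⟨c, ?_⟩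
    have := congrArg Subtype.val hc
    simp only [SetLike.val_smul] at this
    rw [this, sub_add_cancel]
  have hdec : ∀ z : I ⊗[ℂ] V, ∃ v, z = ω ⊗ₜ[ℂ] v + i ⊗ₜ[ℂ] contract V φ z := by
    intro z
    induction z using TensorProduct.induction_on with
    | zero => exact ⟨0, by simp⟩
    | tmul a v =>
      obtain ⟨c, hc⟩ := hspan a
      refine ⟨c • v, ?_⟩
      conv_lhs => rw [hc]
      rw [contract_tmul, TensorProduct.add_tmul, TensorProduct.smul_tmul, TensorProduct.smul_tmul]
    | add x y hx hy =>
      obtain ⟨v, hv⟩ := hx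
      obtain ⟨v', hv'⟩ := hy
      refine ⟨v + v', ?_⟩
      conv_lhs => rw [hv, hv']
      rw [map_add, TensorProduct.tmul_add, TensorProduct.tmul_add]
      abel
  ext z
  constructor
  · intro hz
    obtain ⟨v, hv⟩ := hdec z
    rw [LinearMap.mem_ker.mp hz, TensorProduct.tmul_zero, add_zero] at hv
    exact ⟨v, hv.symm⟩
  · rintro ⟨v, rfl⟩
    simp [h]

theorem finrank_range_contract_comp [FiniteDimensional ℂ I] [FiniteDimensional ℂ V]
    (hI : Module.finrank ℂ I = 2) {φ : Module.Dual ℂ I} (hφ : φ ≠ 0) {ω : I} (hω : ω ≠ 0)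
    (h : φ ω = 0) (B : W →ₗ[ℂ] I ⊗[ℂ] V) :
    Module.finrank ℂ (LinearMap.range (contract V φ ∘ₗ B)) +
      Module.finrank ℂ (R V ω ⊓ LinearMap.range B : Submodule ℂ (I ⊗[ℂ] V)) =
    Module.finrank ℂ (LinearMap.range B) := by
  rw [← LinearMap.finrank_range_add_finrank_ker ((contract V φ).domRestrict (LinearMap.range B)),
    LinearMap.range_domRestrict, LinearMap.range_comp, LinearMap.ker_domRestrict,
    ker_contract hI hφ hω h, inf_comm, ← Submodule.map_comap_subtype,
    Submodule.finrank_map_subtype_eq]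

/-- As `I` has dimension two, rank at most one means a nonzero kernel. -/
theorem mem_D_iff [FiniteDimensional ℂ I] (hI : Module.finrank ℂ I = 2)
    {A : ℙ ℂ (W →ₗ[ℂ] I ⊗[ℂ] V)} {x : ℙ ℂ (Module.Dual ℂ V)} :
    x ∈ D A ↔ ∃ φ : Module.Dual ℂ I, φ ≠ 0 ∧ ∀ w, x.rep (contract V φ (A.rep w)) = 0 := by
  have h1 := LinearMap.finrank_range_add_finrank_ker (fiberMap A.rep x.rep)
  rw [Subspace.dual_finrank_eq, hI] at h1
  have h2 : x ∈ D A ↔ LinearMap.ker (fiberMap A.rep x.rep) ≠ ⊥ := by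
    rw [ne_eq, ← Submodule.finrank_eq_zero]
    change Module.finrank ℂ (LinearMap.range (fiberMap A.rep x.rep)) ≤ 1 ↔ _
    omega
  rw [h2, Submodule.ne_bot_iff]
  refine exists_congr fun φ => ?_
  rw [and_comm, LinearMap.mem_ker, LinearMap.ext_iff]
  simp [fiberMap_eq_contract]

theorem linearLocus_subset_D [FiniteDimensional ℂ I] (hI : Module.finrank ℂ I = 2)
    (A : ℙ ℂ (W →ₗ[ℂ] I ⊗[ℂ] V)) {φ : Module.Dual ℂ I} (hφ : φ ≠ 0) :
    linearLocus (LinearMap.range (contract V φ ∘ₗ A.rep)).dualAnnihilator ⊆ D A := by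
  intro x hx
  refine (mem_D_iff hI).mpr ⟨φ, hφ, fun w => ?_⟩
  exact (Submodule.mem_dualAnnihilator _).mp hx _ ⟨w, rfl⟩

/-- If every slice of `A` has corank at most `k`, then the degeneracy locus of `A` has dimension
at most `k`. -/
theorem zariskiDim_D_le [FiniteDimensional ℂ I] [FiniteDimensional ℂ V]
    (hI : Module.finrank ℂ I = 2) (A : ℙ ℂ (W →ₗ[ℂ] I ⊗[ℂ] V)) {k : ℕ}
    (h : ∀ φ : Module.Dual ℂ I, φ ≠ 0 →
      Module.finrank ℂ V ≤ Module.finrank ℂ (LinearMap.range (contract V φ ∘ₗ A.rep)) + k) :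
    zariskiDim (D A) ≤ k := by
  refine zariskiDim_le fun Z hZ hirr => ?_
  have := coneIdeal_isPrime hirr
  let e := Module.finBasisOfFinrankEq ℂ (Module.Dual ℂ I) (Subspace.dual_finrank_eq.trans hI)
  let L := FractionRing (MvPolynomial (Module.Dual ℂ (Module.Dual ℂ V)) ℂ ⧸ coneIdeal Z)
  let f := IsScalarTower.toAlgHom ℂ
    (MvPolynomial (Module.Dual ℂ (Module.Dual ℂ V)) ℂ ⧸ coneIdeal Z) L
  -- This is the generic point of the affine cone over `Z`.
  let x : V →ₗ[ℂ] L := f.toLinearMap ∘ₗ coordinate Z ∘ₗ Module.Dual.eval ℂ V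
  suffices ∃ s : Finset L, s.card ≤ k + 1 ∧
      ∀ v, x v ∈ IntermediateField.adjoin ℂ (s : Set L) by
    obtain ⟨s, hs, hsx⟩ := this
    refine ringKrullDim_le_of_forall_mem_adjoin (k := ℂ) f (IsFractionRing.injective _ L) s hs
      fun b => ?_
    refine range_le_of_coordinate_mem Z f (IntermediateField.adjoin ℂ (s : Set L)).toSubalgebra
      (fun l => ?_) b
    obtain ⟨v, rfl⟩ := (Module.evalEquiv ℂ V).surjective l
    exact hsx v
  refine exists_adjoin_of_pencil (contract V (e 0) ∘ₗ A.rep) (contract V (e 1) ∘ₗ A.rep) x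
    (fun w w' => ?_) (fun s t hst => ?_)
  · change f (coordinate Z _) * f (coordinate Z _) = f (coordinate Z _) * f (coordinate Z _)
    rw [← map_mul f, ← map_mul f]
    refine congrArg f ?_
    change Ideal.Quotient.mk _ _ * Ideal.Quotient.mk _ _ =
      Ideal.Quotient.mk _ _ * Ideal.Quotient.mk _ _
    rw [← map_mul, ← map_mul, Ideal.Quotient.eq]
    intro ξ hξ t
    -- At each point of `Z` some nontrivial combination of the two slices is killed, so all `2 × 2`
    -- minors vanish there; being quadratic, they scale by `t ^ 2` along the cone.
    obtain ⟨φ, hφ, hφA⟩ := (mem_D_iff hI).mp (hZ hξ)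
    have hφe : φ = e.repr φ 0 • e 0 + e.repr φ 1 • e 1 := by
      conv_lhs => rw [← e.sum_repr φ, Fin.sum_univ_two]
    have h0 : e.repr φ 0 ≠ 0 ∨ e.repr φ 1 ≠ 0 := by
      by_contra! hcon
      exact hφ (by rw [hφe, hcon.1, hcon.2, zero_smul, zero_smul, add_zero])
    rw [hφe, contract_add] at hφA
    have h1 := hφA w
    have h2 := hφA w'
    simp only [LinearMap.add_apply, LinearMap.smul_apply, map_add, map_smul, smul_eq_mul] at h1 h2
    have h3 : ξ.rep (contract V (e 0) (A.rep w)) * ξ.rep (contract V (e 1) (A.rep w')) -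
        ξ.rep (contract V (e 0) (A.rep w')) * ξ.rep (contract V (e 1) (A.rep w)) = 0 := by
      rcases h0 with h0 | h0
      · refine (mul_eq_zero_iff_left h0).mp ?_
        linear_combination ξ.rep (contract V (e 1) (A.rep w')) * h1 -
          ξ.rep (contract V (e 1) (A.rep w)) * h2
      · refine (mul_eq_zero_iff_left h0).mp ?_
        linear_combination ξ.rep (contract V (e 0) (A.rep w)) * h2 -
          ξ.rep (contract V (e 0) (A.rep w')) * h1
    simp only [evalForm, map_sub, map_mul, MvPolynomial.eval_X, map_smul, smul_eq_mul,
      Module.Dual.eval_apply, LinearMap.comp_apply]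
    linear_combination t ^ 2 * h3
  · have h1 : s • e 0 + t • e 1 ≠ 0 := by
      intro h0
      have h2 := congrArg (fun φ => e.repr φ 0) h0
      have h3 := congrArg (fun φ => e.repr φ 1) h0
      simp at h2 h3
      tauto
    have h2 := h _ h1
    rwa [contract_add, LinearMap.add_comp, LinearMap.smul_comp, LinearMap.smul_comp] at h2

end Slices

/-! ### Destabilizing one-parameter subgroups. -/

section Stability

variable {I V W : Type*} [AddCommGroup I] [Module ℂ I] [AddCommGroup V] [Module ℂ V]
  [AddCommGroup W] [Module ℂ W]

/-- A form of positive degree that is constant on a punctured curve through the origin vanishes on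
that curve. -/
theorem evalForm_eq_zero_of_curve {E : Type*} [AddCommGroup E] [Module ℂ E]
    {p : MvPolynomial (Module.Dual ℂ E) ℂ} {d : ℕ} (hp : p.IsHomogeneous d) (hd : 0 < d)
    {c : ℂ → E} (hc : ∀ l : Module.Dual ℂ E, Continuous fun t => l (c t)) (hc0 : c 0 = 0) {e : E}
    (h : ∀ t, t ≠ 0 → evalForm p (c t) = evalForm p e) : evalForm p e = 0 := by
  have hcont : Continuous fun t => evalForm p (c t) := by
    simp only [evalForm, MvPolynomial.eval_eq]
    exact continuous_finsetSum _ fun s _ => continuous_const.mul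
      (continuous_finsetProd _ fun l _ => (hc l).pow _)
  have h1 := Continuous.ext_on (dense_compl_singleton (0 : ℂ)) hcont
    (continuous_const (y := evalForm p e)) fun t ht => h t ht
  have h2 := congrFun h1 0
  have h3 := evalForm_smul hp (0 : ℂ) (0 : E)
  rw [zero_smul, zero_pow hd.ne', zero_mul] at h3
  rw [← h2, hc0, h3]

/-- The automorphism acting by two scalars on two complementary subspaces. -/
noncomputable def twoScalars {P Q : Submodule ℂ W} (h : IsCompl P Q) (a b : ℂˣ) : W ≃ₗ[ℂ] W :=
  (Submodule.prodEquivOfIsCompl P Q h).symm ≪≫ₗ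
    (LinearEquiv.smulOfUnit a).prodCongr (LinearEquiv.smulOfUnit b) ≪≫ₗ
    Submodule.prodEquivOfIsCompl P Q h

theorem twoScalars_apply {P Q : Submodule ℂ W} (h : IsCompl P Q) (a b : ℂˣ) {x y : W}
    (hx : x ∈ P) (hy : y ∈ Q) :
    twoScalars h a b (x + y) = (a : ℂ) • x + (b : ℂ) • y := by
  have h1 : (Submodule.prodEquivOfIsCompl P Q h).symm (x + y) = (⟨x, hx⟩, ⟨y, hy⟩) := by
    rw [LinearEquiv.symm_apply_eq]
    simp
  simp only [twoScalars, LinearEquiv.trans_apply, h1]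
  simp [LinearEquiv.smulOfUnit, Units.smul_def]

theorem twoScalars_toLinearMap {P Q : Submodule ℂ W} (h : IsCompl P Q) (a b : ℂˣ) :
    (twoScalars h a b).toLinearMap =
      (a : ℂ) • P.projection Q h + (b : ℂ) • Q.projection P h.symm := by
  ext z
  have h1 := twoScalars_apply h a b (P.projection_apply_mem h z)
    (Q.projection_apply_mem h.symm z)
  rw [Submodule.projection_add_projection_eq_self] at h1
  exact h1

theorem twoScalars_det {P Q : Submodule ℂ W} [FiniteDimensional ℂ W] (h : IsCompl P Q)
    (a b : ℂˣ) : LinearEquiv.det (twoScalars h a b) =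
      a ^ Module.finrank ℂ P * b ^ Module.finrank ℂ Q := by
  ext
  have h1 : (twoScalars h a b).toLinearMap =
      (Submodule.prodEquivOfIsCompl P Q h).toLinearMap ∘ₗ
        (LinearMap.prodMap ((a : ℂ) • LinearMap.id) ((b : ℂ) • LinearMap.id)) ∘ₗ
        (Submodule.prodEquivOfIsCompl P Q h).symm.toLinearMap := by
    rfl
  rw [LinearEquiv.coe_det, h1, LinearMap.det_conj, LinearMap.det_prodMap, LinearMap.det_smul,
    LinearMap.det_smul, LinearMap.det_id, LinearMap.det_id]
  simp

theorem continuous_dual_apply_smul {E : Type*} [AddCommGroup E] [Module ℂ E]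
    (l : Module.Dual ℂ E) {f : ℂ → ℂ} (hf : Continuous f) (e : E) :
    Continuous fun t => l (f t • e) := by
  simp only [map_smul, smul_eq_mul]
  exact hf.mul continuous_const

/-- If `A` kills `w`, let `t` act on a complement of the line of `w`, and compensate the determinant
on that line. Then `t • A` lies in the orbit for every `t ≠ 0` and tends to `0`. -/
theorem rep_injective_of_mem_Xss [FiniteDimensional ℂ W]
    {A : ℙ ℂ (W →ₗ[ℂ] I ⊗[ℂ] V)} (hA : A ∈ Xss I V W) : Function.Injective A.rep := by
  obtain ⟨d, hd, p, hp, hinv, hpA⟩ := hA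
  rw [← LinearMap.ker_eq_bot]
  by_contra hker
  obtain ⟨w, hw, hw0⟩ := Submodule.exists_mem_ne_zero_of_ne_bot hker
  obtain ⟨Q, hQ⟩ := Submodule.exists_isCompl (Submodule.span ℂ {w})
  have hdim := Submodule.finrank_add_eq_of_isCompl hQ
  rw [finrank_span_singleton hw0] at hdim
  refine hpA (evalForm_eq_zero_of_curve hp hd (c := fun t => t • A.rep)
    (fun l => continuous_dual_apply_smul l continuous_id _) (zero_smul _ _) fun t ht => ?_)
  let u : ℂˣ := Units.mk0 t ht
  have hdet : LinearEquiv.det (twoScalars hQ (u⁻¹ ^ Module.finrank ℂ Q) u).symm = 1 := by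
    rw [LinearEquiv.det_symm, map_inv, twoScalars_det, finrank_span_singleton hw0]
    simp
  rw [← hinv 1 ⟨_, hdet⟩ A.rep]
  congr 1
  ext z
  obtain ⟨x, hx, y, hy, rfl⟩ : ∃ x ∈ Submodule.span ℂ {w}, ∃ y ∈ Q, x + y = z :=
    Submodule.mem_sup.mp (hQ.sup_eq_top ▸ Submodule.mem_top)
  have hAx : A.rep x = 0 := (Submodule.span_le.mpr (by simpa using hw) :
    Submodule.span ℂ {w} ≤ LinearMap.ker A.rep) hx
  rw [act_apply]
  change _ = TensorProduct.map LinearMap.id LinearMap.id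
    (A.rep (twoScalars hQ (u⁻¹ ^ Module.finrank ℂ Q) u (x + y)))
  rw [twoScalars_apply hQ _ _ hx hy, TensorProduct.map_id]
  simp [hAx, u]

/-- Let `P` be the preimage of `R V ω`, of dimension `s` and codimension `r`, and suppose `s > r`.
Give `P` and a complement `Q` weights `-2r` and `2s`, and `ω` and a complement `M` weights `s + r`
and `-(s + r)`; both determinants are `1`. The block from `P` to `M` is zero, those from `P` to `ω`
and from `Q` to `M` scale by `t ^ (s - r)`, and the one from `Q` to `ω` by `t ^ (3 * s + r)`. All
exponents are positive, so the orbit closure contains `0`. -/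
theorem finrank_R_inf_T_le [FiniteDimensional ℂ I] [FiniteDimensional ℂ V] [FiniteDimensional ℂ W]
    (hI : Module.finrank ℂ I = 2)
    {A : ℙ ℂ (W →ₗ[ℂ] I ⊗[ℂ] V)} (hA : A ∈ Xss I V W) {ω : I} (hω : ω ≠ 0) :
    2 * Module.finrank ℂ (R V ω ⊓ T A : Submodule ℂ (I ⊗[ℂ] V)) ≤ Module.finrank ℂ W := by
  have hinj := rep_injective_of_mem_Xss hA
  obtain ⟨d, hd, p, hp, hinv, hpA⟩ := hA
  by_contra! hlt
  let P := (R V ω).comap A.rep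
  have hP : Module.finrank ℂ (R V ω ⊓ T A : Submodule ℂ (I ⊗[ℂ] V)) = Module.finrank ℂ P := by
    rw [inf_comm, T, ← Submodule.map_comap_eq, ← LinearEquiv.finrank_eq (Submodule.equivMapOfInjective _ hinj _)]
  rw [hP] at hlt
  obtain ⟨Q, hQ⟩ := Submodule.exists_isCompl P
  have hdim := Submodule.finrank_add_eq_of_isCompl hQ
  obtain ⟨M, hM⟩ := Submodule.exists_isCompl (Submodule.span ℂ {ω})
  have hdimM := Submodule.finrank_add_eq_of_isCompl hM
  rw [finrank_span_singleton hω, hI] at hdimM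
  set s := Module.finrank ℂ P
  set r := Module.finrank ℂ Q
  let σ : I →ₗ[ℂ] I := (Submodule.span ℂ {ω}).projection M hM
  let σ' : I →ₗ[ℂ] I := M.projection (Submodule.span ℂ {ω}) hM.symm
  let π : W →ₗ[ℂ] W := P.projection Q hQ
  let π' : W →ₗ[ℂ] W := Q.projection P hQ.symm
  let B₀ : W →ₗ[ℂ] I ⊗[ℂ] V := A.rep ∘ₗ π + TensorProduct.map σ' LinearMap.id ∘ₗ A.rep ∘ₗ π'
  let B₁ : W →ₗ[ℂ] I ⊗[ℂ] V := TensorProduct.map σ LinearMap.id ∘ₗ A.rep ∘ₗ π'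
  refine hpA (evalForm_eq_zero_of_curve hp hd
    (c := fun t => t ^ (s - r) • B₀ + t ^ (s + r + 2 * s) • B₁) (fun l => ?_) ?_ fun t ht => ?_)
  · simp only [map_add]
    exact (continuous_dual_apply_smul l (continuous_pow _) _).add
      (continuous_dual_apply_smul l (continuous_pow _) _)
  · change (0 : ℂ) ^ (s - r) • B₀ + (0 : ℂ) ^ (s + r + 2 * s) • B₁ = 0
    rw [zero_pow (by omega), zero_pow (by omega), zero_smul, zero_smul, add_zero]
  let u : ℂˣ := Units.mk0 t ht
  have hdetW : LinearEquiv.det (twoScalars hQ (u⁻¹ ^ (2 * r)) (u ^ (2 * s))).symm = 1 := by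
    rw [LinearEquiv.det_symm, map_inv, twoScalars_det, ← pow_mul, ← pow_mul, inv_pow, inv_eq_one,
      inv_mul_eq_one]
    congr 1
    ring
  have hdetI : LinearEquiv.det (twoScalars hM (u ^ (s + r)) (u⁻¹ ^ (s + r))) = 1 := by
    rw [twoScalars_det, finrank_span_singleton hω, show Module.finrank ℂ M = 1 by omega]
    simp
  rw [← hinv ⟨_, hdetI⟩ ⟨_, hdetW⟩ A.rep]
  congr 1
  ext z
  obtain ⟨v, hv⟩ : π z ∈ P := P.projection_apply_mem hQ z
  rw [act_apply]
  change _ = TensorProduct.map (twoScalars hM (u ^ (s + r)) (u⁻¹ ^ (s + r))).toLinearMap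
    LinearMap.id (A.rep ((twoScalars hQ (u⁻¹ ^ (2 * r)) (u ^ (2 * s))).toLinearMap z))
  have hσω : σ ω = ω := Submodule.projection_apply_of_mem_left hM
    (Submodule.mem_span_singleton_self ω)
  have hσ'ω : σ' ω = 0 := (Submodule.projection_apply_eq_zero_iff hM.symm).mpr
    (Submodule.mem_span_singleton_self ω)
  obtain ⟨k, hk⟩ : ∃ k, s = r + k := ⟨s - r, by omega⟩
  have e1 : t ^ (s - r) = (t⁻¹) ^ (2 * r) * t ^ (s + r) := by
    rw [hk, Nat.add_sub_cancel_left, inv_pow, eq_inv_mul_iff_mul_eq₀ (pow_ne_zero _ ht)]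
    ring
  have e2 : t ^ (s - r) = t ^ (2 * s) * (t⁻¹) ^ (s + r) := by
    rw [hk, Nat.add_sub_cancel_left, inv_pow, eq_mul_inv_iff_mul_eq₀ (pow_ne_zero _ ht)]
    ring
  have e3 : t ^ (s + r + 2 * s) = t ^ (2 * s) * t ^ (s + r) := by ring
  rw [twoScalars_toLinearMap, twoScalars_toLinearMap, TensorProduct.map_add_left,
    TensorProduct.map_smul_left, TensorProduct.map_smul_left]
  change t ^ (s - r) • (A.rep (π z) + TensorProduct.map σ' LinearMap.id (A.rep (π' z))) +
    t ^ (s + r + 2 * s) • TensorProduct.map σ LinearMap.id (A.rep (π' z)) =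
    ((u ^ (s + r) : ℂˣ) : ℂ) • TensorProduct.map σ LinearMap.id
      (A.rep (((u⁻¹ ^ (2 * r) : ℂˣ) : ℂ) • π z + ((u ^ (2 * s) : ℂˣ) : ℂ) • π' z)) +
    ((u⁻¹ ^ (s + r) : ℂˣ) : ℂ) • TensorProduct.map σ' LinearMap.id
      (A.rep (((u⁻¹ ^ (2 * r) : ℂˣ) : ℂ) • π z + ((u ^ (2 * s) : ℂˣ) : ℂ) • π' z))
  simp only [map_add, map_smul, ← hv, TensorProduct.mk_apply, TensorProduct.map_tmul, hσω, hσ'ω,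
    TensorProduct.zero_tmul, LinearMap.id_apply, Units.val_pow_eq_pow_val, Units.val_inv_eq_inv_val,
    smul_add, smul_smul, smul_zero, zero_add, u, Units.val_mk0]
  nth_rw 1 [e1]
  rw [e2, e3]
  module

end Stability

/-! ### Invariance under the group. -/

section Invariance

variable {I V W : Type*} [AddCommGroup I] [Module ℂ I] [AddCommGroup V] [Module ℂ V]
  [AddCommGroup W] [Module ℂ W]

theorem exists_rep_actP (g : SpecialLinearGroup ℂ I) (h : SpecialLinearGroup ℂ W)
    (A : ℙ ℂ (W →ₗ[ℂ] I ⊗[ℂ] V)) :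
    ∃ c : ℂ, c ≠ 0 ∧ (actP g h A).rep = c • act V g h A.rep := by
  have hne : act V g h A.rep ≠ 0 := (LinearEquiv.map_ne_zero_iff _).mpr A.rep_nonzero
  have h1 : actP g h A = Projectivization.mk ℂ (act V g h A.rep) hne := by
    conv_lhs => rw [← A.mk_rep]
    rfl
  obtain ⟨a, ha⟩ := Projectivization.exists_smul_eq_mk_rep ℂ _ hne
  exact ⟨a, a.ne_zero, by rw [h1, ← ha, Units.smul_def]⟩

theorem isInvariant_Xss : IsInvariant (Xss I V W) := by
  rintro g h A ⟨d, hd, p, hp, hinv, hpA⟩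
  obtain ⟨c, hc, hcA⟩ := exists_rep_actP g h A
  refine ⟨d, hd, p, hp, hinv, ?_⟩
  rw [hcA, evalForm_smul hp, hinv]
  exact mul_ne_zero (pow_ne_zero d hc) hpA

theorem T_actP (g : SpecialLinearGroup ℂ I) (h : SpecialLinearGroup ℂ W)
    (A : ℙ ℂ (W →ₗ[ℂ] I ⊗[ℂ] V)) :
    T (actP g h A) = (T A).map (TensorProduct.congr g.1 (LinearEquiv.refl ℂ V)).toLinearMap := by
  obtain ⟨c, hc, hcA⟩ := exists_rep_actP g h A
  have h1 : act V g h A.rep = (TensorProduct.congr g.1 (LinearEquiv.refl ℂ V)).toLinearMap ∘ₗ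
      A.rep ∘ₗ h.1.symm.toLinearMap := rfl
  rw [T, hcA, LinearMap.range_smul _ _ hc, h1, LinearMap.range_comp, LinearMap.range_comp,
    LinearEquiv.range, Submodule.map_top]
  rfl

theorem map_R (g : SpecialLinearGroup ℂ I) (ω : I) :
    (R V ω).map (TensorProduct.congr g.1 (LinearEquiv.refl ℂ V)).toLinearMap = R V (g.1 ω) := by
  rw [R, R, ← LinearMap.range_comp]
  congr 1

theorem isInvariant_S (n m j : ℕ) : IsInvariant (S I V W n m j) := by
  rintro g h A ⟨hA, ω, hω, hdim⟩
  refine ⟨isInvariant_Xss g h A hA, g.1 ω, (LinearEquiv.map_ne_zero_iff _).mpr hω, ?_⟩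
  rwa [T_actP, ← map_R, ← Submodule.map_inf _ (LinearEquiv.injective _),
    LinearEquiv.finrank_map_eq]

/-- The element `h` only reparametrizes `W`, and `g` permutes the witnesses through `φ ↦ φ ∘ g`. -/
theorem D_actP [FiniteDimensional ℂ I] (hI : Module.finrank ℂ I = 2)
    (g : SpecialLinearGroup ℂ I) (h : SpecialLinearGroup ℂ W)
    (A : ℙ ℂ (W →ₗ[ℂ] I ⊗[ℂ] V)) : D (actP g h A) = D A := by
  obtain ⟨c, hc, hcA⟩ := exists_rep_actP g h A
  ext x
  have key : ∀ φ : Module.Dual ℂ I, (∀ w, x.rep (contract V φ ((actP g h A).rep w)) = 0) ↔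
      ∀ w, x.rep (contract V (φ ∘ₗ g.1.toLinearMap) (A.rep w)) = 0 := by
    intro φ
    rw [h.1.symm.surjective.forall
      (p := fun w => x.rep (contract V (φ ∘ₗ g.1.toLinearMap) (A.rep w)) = 0)]
    refine forall_congr' fun w => ?_
    rw [hcA, LinearMap.smul_apply, act_apply, map_smul, map_smul, contract_map, smul_eq_mul,
      mul_eq_zero_iff_left hc]
  rw [mem_D_iff hI, mem_D_iff hI]
  constructor
  · rintro ⟨φ, hφ, hw⟩
    refine ⟨φ ∘ₗ g.1.toLinearMap, fun h0 => hφ ?_, (key φ).mp hw⟩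
    ext i
    obtain ⟨i, rfl⟩ := g.1.surjective i
    exact LinearMap.congr_fun h0 i
  · rintro ⟨φ, hφ, hw⟩
    have h1 : (φ ∘ₗ g.1.symm.toLinearMap) ∘ₗ g.1.toLinearMap = φ := by
      ext i
      simp
    refine ⟨φ ∘ₗ g.1.symm.toLinearMap, fun h0 => hφ ?_, (key _).mpr (by rwa [h1])⟩
    rw [← h1, h0, LinearMap.zero_comp]

theorem isInvariant_Stilde [FiniteDimensional ℂ I] (hI : Module.finrank ℂ I = 2) (j : ℕ) :
    IsInvariant (Stilde I V W j) := by
  rintro g h A ⟨hA, hdim⟩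
  refine ⟨isInvariant_Xss g h A hA, ?_⟩
  rwa [D_actP hI]

end Invariance

/-! ### The inclusions of the filtration. -/

section Filtration

variable {I V W : Type*} [AddCommGroup I] [Module ℂ I] [FiniteDimensional ℂ I]
  [AddCommGroup V] [Module ℂ V] [FiniteDimensional ℂ V]
  [AddCommGroup W] [Module ℂ W] [FiniteDimensional ℂ W] {n m : ℕ}

omit [FiniteDimensional ℂ I] [FiniteDimensional ℂ V] in
theorem finrank_T {A : ℙ ℂ (W →ₗ[ℂ] I ⊗[ℂ] V)} (hA : A ∈ Xss I V W) :
    Module.finrank ℂ (T A) = Module.finrank ℂ W :=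
  LinearMap.finrank_range_of_inj (rep_injective_of_mem_Xss hA)

theorem finrank_slice_add (hI : Module.finrank ℂ I = 2) {A : ℙ ℂ (W →ₗ[ℂ] I ⊗[ℂ] V)}
    (hA : A ∈ Xss I V W) {φ : Module.Dual ℂ I} (hφ : φ ≠ 0) {ω : I} (hω : ω ≠ 0) (h : φ ω = 0) :
    Module.finrank ℂ (LinearMap.range (contract V φ ∘ₗ A.rep)) +
      Module.finrank ℂ (R V ω ⊓ T A : Submodule ℂ (I ⊗[ℂ] V)) = Module.finrank ℂ W := by
  rw [← finrank_T hA]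
  exact finrank_range_contract_comp hI hφ hω h A.rep

theorem S_subset_Stilde (hI : Module.finrank ℂ I = 2) (hV : Module.finrank ℂ V = n + 1)
    (hW : Module.finrank ℂ W = m + 2) {j : ℕ} (hj : 2 ≤ j) : S I V W n m j ⊆ Stilde I V W j := by
  rintro A ⟨hA, ω, hω, hdim⟩
  refine ⟨hA, Or.inr ?_⟩
  obtain ⟨φ, hφ, hφω⟩ := exists_dual_ne_zero_apply_eq_zero hI ω
  have h1 := finrank_slice_add hI hA hφ hω hφω
  have h2 := Subspace.finrank_add_finrank_dualAnnihilator_eq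
    (LinearMap.range (contract V φ ∘ₗ A.rep))
  refine le_zariskiDim_of_linearLocus_subset (linearLocus_subset_D hI A hφ) ?_
  omega

theorem Stilde_subset_S (hI : Module.finrank ℂ I = 2) (hV : Module.finrank ℂ V = n + 1)
    (hW : Module.finrank ℂ W = m + 2) {j : ℕ} (hj : 2 ≤ j) :
    Stilde I V W (j + 1) ⊆ S I V W n m j := by
  rintro A ⟨hA, hdim⟩
  by_contra hcon
  have hlt : ∀ ω : I, ω ≠ 0 →
      (Module.finrank ℂ (R V ω ⊓ T A : Submodule ℂ (I ⊗[ℂ] V)) : ℤ) < j + m - n := by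
    intro ω hω
    by_contra! hle
    exact hcon ⟨hA, ω, hω, hle⟩
  -- Outside `S^j` every slice has corank at most `j - 2`.
  have hD : zariskiDim (D A) ≤ (j - 2 : ℕ) := by
    refine zariskiDim_D_le hI A fun φ hφ => ?_
    obtain ⟨ω, hω, hφω⟩ := exists_ne_zero_dual_apply_eq_zero hI φ
    have h1 := finrank_slice_add hI hA hφ hω hφω
    have h2 := hlt ω hω
    omega
  rcases hdim with h | h
  · push_cast at h
    omega
  · have h1 := h.trans hD
    rw [show (((j + 1 : ℕ) : ℤ) - 2).toNat = j - 1 by omega] at h1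
    have h2 : j - 1 ≤ j - 2 := Nat.cast_le.mp (WithBot.coe_le_coe.mp h1 : (_ : ℕ∞) ≤ _)
    omega

theorem Stilde_two_subset_S (hI : Module.finrank ℂ I = 2) (hV : Module.finrank ℂ V = n + 1)
    (hW : Module.finrank ℂ W = m + 2) : Stilde I V W 2 ⊆ S I V W n m 2 := by
  rintro A ⟨hA, hdim⟩
  rcases hdim with h | h
  · norm_num at h
  obtain ⟨x, hx⟩ := nonempty_of_zariskiDim_nonneg (Y := D A) (by simpa using h)
  obtain ⟨φ, hφ, hφA⟩ := (mem_D_iff hI).mp hx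
  obtain ⟨ω, hω, hφω⟩ := exists_ne_zero_dual_apply_eq_zero hI φ
  refine ⟨hA, ω, hω, ?_⟩
  have h1 := finrank_slice_add hI hA hφ hω hφω
  have h2 : Module.finrank ℂ (LinearMap.range (contract V φ ∘ₗ A.rep)) <
      Module.finrank ℂ V := by
    -- The functional `x.rep` is nonzero and vanishes on the range, so the slice is not surjective.
    refine Submodule.finrank_lt fun htop => x.rep_nonzero (LinearMap.ext fun v => ?_)
    obtain ⟨w, rfl⟩ := LinearMap.range_eq_top.mp htop v
    exact hφA w
  omega

theorem S_one_eq (hI : Module.finrank ℂ I = 2) (hV : Module.finrank ℂ V = n + 1)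
    (hW : Module.finrank ℂ W = m + 2) : S I V W n m 1 = Xss I V W := by
  refine Set.Subset.antisymm (fun A hA => hA.1) fun A hA => ⟨hA, ?_⟩
  have : Nontrivial I := Module.nontrivial_of_finrank_pos (R := ℂ) (by omega)
  obtain ⟨ω, hω⟩ := exists_ne (0 : I)
  refine ⟨ω, hω, ?_⟩
  obtain ⟨φ, hφ, hφω⟩ := exists_dual_ne_zero_apply_eq_zero hI ω
  have h1 := finrank_slice_add hI hA hφ hω hφω
  have h2 := Submodule.finrank_le (LinearMap.range (contract V φ ∘ₗ A.rep))
  omega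

omit [FiniteDimensional ℂ I] [FiniteDimensional ℂ V] [FiniteDimensional ℂ W] in
theorem Stilde_one_eq : Stilde I V W 1 = Xss I V W :=
  Set.Subset.antisymm (fun _ hA => hA.1) fun _ hA => ⟨hA, Or.inl (by norm_num)⟩

/-- Membership would need an intersection of dimension at least `(m + 3) / 2 + 1`, above the bound
`(m + 2) / 2` from stability. By `hmn` the natural subtraction does not truncate. -/
theorem S_eq_empty (hI : Module.finrank ℂ I = 2) (hW : Module.finrank ℂ W = m + 2)
    (hmn : m + 2 ≤ 2 * (n + 1)) : S I V W n m ((m + 3) / 2 + n - m + 1) = ∅ := by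
  refine Set.eq_empty_of_forall_notMem ?_
  rintro A ⟨hA, ω, hω, hdim⟩
  have h1 := finrank_R_inf_T_le hI hA hω
  omega

end Filtration

end SteinerFiltration

theorem theorem2p2 {I V W : Type*}
    [AddCommGroup I] [Module ℂ I] [FiniteDimensional ℂ I]
    [AddCommGroup V] [Module ℂ V] [FiniteDimensional ℂ V]
    [AddCommGroup W] [Module ℂ W] [FiniteDimensional ℂ W]
    (n m : ℕ) (hI : Module.finrank ℂ I = 2) (hV : Module.finrank ℂ V = n + 1)
    (hW : Module.finrank ℂ W = m + 2) (hmn : m + 2 ≤ 2 * (n + 1)) :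
    (∀ j : ℕ, 2 ≤ j →
      SteinerFiltration.S I V W n m j ⊆ SteinerFiltration.Stilde I V W j ∧
      SteinerFiltration.Stilde I V W j ⊆ SteinerFiltration.S I V W n m (j - 1)) ∧
    SteinerFiltration.S I V W n m 2 = SteinerFiltration.Stilde I V W 2 ∧
    SteinerFiltration.S I V W n m 1 = SteinerFiltration.Xss I V W ∧
    SteinerFiltration.Stilde I V W 1 = SteinerFiltration.Xss I V W ∧
    -- the resulting interleaved filtration: decreasing, from `X^{ss}` to the empty set
    -- `S^{j₀ + 1}` with `j₀ = ⌊(m + 3) / 2⌋ + n - m`, with all members invariant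
    Antitone (SteinerFiltration.interleaved I V W n m) ∧
    SteinerFiltration.interleaved I V W n m 0 = SteinerFiltration.Xss I V W ∧
    SteinerFiltration.S I V W n m ((m + 3) / 2 + n - m + 1) = ∅ ∧
    (∀ k : ℕ, SteinerFiltration.IsInvariant (SteinerFiltration.interleaved I V W n m k)) := by
  have hS1 := S_one_eq (I := I) hI hV hW
  have hT1 : Stilde I V W 1 = Xss I V W := Stilde_one_eq
  have hchain : ∀ j : ℕ, 1 ≤ j → Stilde I V W (j + 1) ⊆ S I V W n m j := by
    intro j hj
    rcases hj.eq_or_lt with rfl | hj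
    · rw [hS1]
      exact fun A hA => hA.1
    · exact Stilde_subset_S hI hV hW hj
  have hchain' : ∀ j : ℕ, 1 ≤ j → S I V W n m j ⊆ Stilde I V W j := by
    intro j hj
    rcases hj.eq_or_lt with rfl | hj
    · rw [hS1, hT1]
    · exact S_subset_Stilde hI hV hW hj
  refine ⟨fun j hj => ⟨hchain' j (by omega), ?_⟩, ?_, hS1, hT1, ?_, ?_, S_eq_empty hI hW hmn, ?_⟩
  · have := hchain (j - 1) (by omega)
    rwa [Nat.sub_add_cancel (by omega)] at this
  · exact (hchain' 2 one_le_two).antisymm (Stilde_two_subset_S hI hV hW)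
  -- From an even index the step is `S^j ⊆ S̃^j`; from an odd one it is `S̃^(j+1) ⊆ S^j`.
  · refine antitone_nat_of_succ_le fun k => ?_
    rcases Nat.even_or_odd k with hk | hk
    · have h1 : ¬ Even (k + 1) := by rw [Nat.even_add_one]; simpa using hk
      obtain ⟨l, rfl⟩ := hk
      rw [interleaved, interleaved, if_neg h1, if_pos ⟨l, rfl⟩,
        show (l + l + 1) / 2 = (l + l) / 2 by omega]
      exact hchain' _ (by omega)
    · have h1 : Even (k + 1) := hk.add_one
      have h2 : ¬ Even k := Nat.not_even_iff_odd.mpr hk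
      obtain ⟨l, rfl⟩ := hk
      rw [interleaved, interleaved, if_pos h1, if_neg h2,
        show (2 * l + 1 + 1) / 2 = (2 * l + 1) / 2 + 1 by omega]
      exact hchain _ (by omega)
  · rw [interleaved, if_pos (by simp)]
    exact hT1
  · intro k
    rw [interleaved]
    split_ifs
    · exact isInvariant_Stilde hI _
    · exact isInvariant_S _ _ _
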